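/- Let $n\ge 1$ and let $\mathbb H_n$ be the Siegel upper half space of complex symmetric $n\times n$ matrices $Z=X+iY$ with $Y$ positive definite. For $g=\begin{pmatrix}A&B\\C&D\end{pmatrix}\in \mathrm{Sp}_{2n}(\mathbb R)$ put $gZ=(AZ+B)(CZ+D)^{-1}$ and $J(g,Z)=CZ+D$. For an integer $p\ge 0$ let $T_n^p$ be the set of tuples $\mathbf b=(b_{i,j})_{1\le i\le j\le n}$ of non-negative integers with $\sum b_{i,j}\le p$, and for a real symmetric matrix $V=(v_{i,j})$ put $[V]^{\mathbf b}=\prod_{i\le j}v_{i,j}^{b_{i,j}}$. Let $N^p(\mathbb H_n)$ be the set of functions $f:\mathbb H_n\to\mathbb C$ of the form $f(Z)=\sum_{\mathbf b\in T_n^p}G_{\mathbf b}(Z)[Y^{-1}]^{\mathbf b}$ with $G_{\mathbf b}$ holomorphic on $\mathbb H_n$. Such an $f$ has a nice Fourier expansion if there are a positive integer $N$ and complex numbers $a_{\mathbf b}(S)$ such that $$f(Z)=\sum_{\mathbf b\in T_n^p}\ \sum_{S}a_{\mathbf b}(S)\,e^{2\pi i\,\mathrm{Tr}(SZ)}\,[Y^{-1}]^{\mathbf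 b},$$ where $S$ runs over the positive semidefinite matrices in $\frac1N M_n^{\mathrm{sym}}(\mathbb Z)$ ($M_n^{\mathrm{sym}}(\mathbb Z)$ being the symmetric integral $n\times n$ matrices), the sum over all pairs $(\mathbf b,S)$ converging absolutely and uniformly on compact subsets of $\mathbb H_n$. Let $(\rho,V)$ be a finite-dimensional irreducible rational representation of $\mathrm{GL}_n(\mathbb C)$ with highest weight $\lambda_1\ge\dots\ge\lambda_n\ge 0$ (integers), and let $\|\cdot\|$ be the norm of a $\mathrm U(n)$-invariant inner product on $V$. For $F:\mathbb H_n\to V$ and $g\in\mathrm{Sp}_{2n}(\mathbb R)$ put $(F|_\rho g)(Z)=\rho(J(g,Z))^{-1}F(gZ)$. A congruence subgroup of $\mathrm{Sp}_{2n}(\mathbb Q)$ is a subgroup that is commensurable with $\mathrm{Sp}_{2n}(\mathbb Z)$ and contains a principal congruence subgroup of $\mathrm{Sp}_{2n}(\mathbb Z)$. Let $N_\rho^{(n)}$, the space of nearly holomorphic Siegel modular forms of weight $\rho$, be the set of all $F:\mathbb H_n\to V$ for which there are a congruence subgroup $\Gamma$ and an integer $p\ge0$ such that $F|_\rho\gamma=F$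 for all $\gamma\in\Gamma$ and, for every $g\in\mathrm{Sp}_{2n}(\mathbb Q)$ and every linear map $\mathcal L:V\to\mathbb C$, the function $\mathcal L\circ(F|_\rho g)$ lies in $N^p(\mathbb H_n)$ and has a nice Fourier expansion. Then for every $F\in N_\rho^{(n)}$ there is a constant $C_F$ such that for all $Z=X+iY\in\mathbb H_n$ $$\|\rho(Y^{1/2})F(Z)\|\le C_F\,(1+\mathrm{Tr}\,Y)^{n\lambda_1}\,(\det Y)^{-\lambda_1/2},$$ where $Y^{1/2}$ is the positive definite square root of $Y$. -/

import Mathlib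

noncomputable section

namespace NearlyHolomorphicSiegel

open Matrix

/-! ### The Siegel upper half space and the action of the symplectic group -/

/-- The Siegel upper half space of degree `n`: complex symmetric `n × n` matrices whose imaginary
part is positive definite. -/
def siegelUpperHalfSpace (n : ℕ) : Set (Matrix (Fin n) (Fin n) ℂ) :=
  {Z | Z.IsSymm ∧ (Z.map Complex.im).PosDef}

/-- The imaginary part `Y` of `Z = X + iY`. -/
def imPart {n : ℕ} (Z : siegelUpperHalfSpace n) : Matrix (Fin n) (Fin n) ℝ :=
  (Z : Matrix (Fin n) (Fin n) ℂ).map Complex.im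

/-- The homomorphism `Sp_{2n}(R) → Sp_{2n}(S)` induced by a ring homomorphism `R → S`. -/
def spMap (n : ℕ) {R S : Type*} [CommRing R] [CommRing S] (f : R →+* S) :
    symplecticGroup (Fin n) R →* symplecticGroup (Fin n) S where
  toFun g := ⟨g.1.map f, SymplecticGroup.map_mem g.2 f⟩
  map_one' := Subtype.ext (Matrix.map_one f (map_zero f) (map_one f))
  map_mul' g h := Subtype.ext (Matrix.map_mul (f := f))

section Action

variable {n : ℕ}

/-- The numerator `AZ + B` for `g = (A B; C D)`. -/
def numMatrix (g : symplecticGroup (Fin n) ℝ) (Z : siegelUpperHalfSpace n) :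
    Matrix (Fin n) (Fin n) ℂ :=
  g.1.toBlocks₁₁.map Complex.ofReal * (Z : Matrix (Fin n) (Fin n) ℂ) +
    g.1.toBlocks₁₂.map Complex.ofReal

/-- The matrix `J(g, Z) = CZ + D` for `g = (A B; C D)`. -/
def denomMatrix (g : symplecticGroup (Fin n) ℝ) (Z : siegelUpperHalfSpace n) :
    Matrix (Fin n) (Fin n) ℂ :=
  g.1.toBlocks₂₁.map Complex.ofReal * (Z : Matrix (Fin n) (Fin n) ℂ) +
    g.1.toBlocks₂₂.map Complex.ofReal

lemma block_relations (g : symplecticGroup (Fin n) ℝ) :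
    (g.1.toBlocks₁₁.map Complex.ofReal)ᵀ *
        g.1.toBlocks₂₁.map Complex.ofReal =
      (g.1.toBlocks₂₁.map Complex.ofReal)ᵀ *
        g.1.toBlocks₁₁.map Complex.ofReal ∧
    (g.1.toBlocks₁₂.map Complex.ofReal)ᵀ *
        g.1.toBlocks₂₂.map Complex.ofReal =
      (g.1.toBlocks₂₂.map Complex.ofReal)ᵀ *
        g.1.toBlocks₁₂.map Complex.ofReal ∧
    (g.1.toBlocks₁₁.map Complex.ofReal)ᵀ *
        g.1.toBlocks₂₂.map Complex.ofReal -
      (g.1.toBlocks₂₁.map Complex.ofReal)ᵀ *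
        g.1.toBlocks₁₂.map Complex.ofReal = 1 := by
  have h : g.1.map (Complex.ofRealHom) ∈ symplecticGroup (Fin n) ℂ :=
    SymplecticGroup.map_mem g.2 Complex.ofRealHom
  rw [← fromBlocks_toBlocks (g.1.map (Complex.ofRealHom)),
    SymplecticGroup.fromBlocks_mem_iff] at h
  exact h

lemma conjTranspose_ofReal_map (A : Matrix (Fin n) (Fin n) ℝ) :
    (A.map Complex.ofReal)ᴴ = (A.map Complex.ofReal)ᵀ := by
  ext i j
  simp [conjTranspose_apply]

lemma transpose_num_mul_denom (g : symplecticGroup (Fin n) ℝ) (Z : siegelUpperHalfSpace n) :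
    (numMatrix g Z)ᵀ * denomMatrix g Z = (denomMatrix g Z)ᵀ * numMatrix g Z := by
  obtain ⟨h1, h2, h3⟩ := block_relations g
  have hZ : (Z : Matrix (Fin n) (Fin n) ℂ)ᵀ = Z := Z.2.1
  have h3' := congrArg Matrix.transpose h3
  simp only [transpose_sub, transpose_mul, transpose_transpose, transpose_one] at h3'
  unfold numMatrix denomMatrix
  generalize g.1.toBlocks₁₁.map Complex.ofReal = A at *
  generalize g.1.toBlocks₁₂.map Complex.ofReal = B at *
  generalize g.1.toBlocks₂₁.map Complex.ofReal = C at *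
  generalize g.1.toBlocks₂₂.map Complex.ofReal = D at *
  generalize (Z : Matrix (Fin n) (Fin n) ℂ) = W at *
  simp only [transpose_add, transpose_mul, hZ]
  have e : (W * Aᵀ + Bᵀ) * (C * W + D) - (W * Cᵀ + Dᵀ) * (A * W + B) =
      W * (Aᵀ * C - Cᵀ * A) * W + (Bᵀ * D - Dᵀ * B) + W * (Aᵀ * D - Cᵀ * B)
        - (Dᵀ * A - Bᵀ * C) * W := by noncomm_ring
  rw [← sub_eq_zero, e, h1, h2, h3, h3']
  simp

lemma denom_conjTranspose_relation (g : symplecticGroup (Fin n) ℝ) (Z : siegelUpperHalfSpace n) :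
    (denomMatrix g Z)ᴴ * numMatrix g Z - (numMatrix g Z)ᴴ * denomMatrix g Z =
      (Z : Matrix (Fin n) (Fin n) ℂ) - (Z : Matrix (Fin n) (Fin n) ℂ)ᴴ := by
  obtain ⟨h1, h2, h3⟩ := block_relations g
  have h3' := congrArg Matrix.transpose h3
  simp only [transpose_sub, transpose_mul, transpose_transpose, transpose_one] at h3'
  unfold numMatrix denomMatrix
  simp only [conjTranspose_add, conjTranspose_mul, conjTranspose_ofReal_map]
  generalize g.1.toBlocks₁₁.map Complex.ofReal = A at *
  generalize g.1.toBlocks₁₂.map Complex.ofReal = B at *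
  generalize g.1.toBlocks₂₁.map Complex.ofReal = C at *
  generalize g.1.toBlocks₂₂.map Complex.ofReal = D at *
  generalize (Z : Matrix (Fin n) (Fin n) ℂ) = W at *
  have e : (Wᴴ * Cᵀ + Dᵀ) * (A * W + B) - (Wᴴ * Aᵀ + Bᵀ) * (C * W + D) =
      -(Wᴴ * (Aᵀ * C - Cᵀ * A) * W) - (Bᵀ * D - Dᵀ * B) - Wᴴ * (Aᵀ * D - Cᵀ * B)
        + (Dᵀ * A - Bᵀ * C) * W := by noncomm_ring
  rw [e, h1, h2, h3, h3']
  simp [sub_eq_neg_add]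

lemma sub_conjTranspose_of_isSymm {W : Matrix (Fin n) (Fin n) ℂ} (hW : W.IsSymm) :
    W - Wᴴ = (2 * Complex.I) • (W.map Complex.im).map Complex.ofReal := by
  ext i j
  have := hW.apply i j
  simp only [Matrix.sub_apply, conjTranspose_apply, Matrix.smul_apply, map_apply, smul_eq_mul, this]
  apply Complex.ext <;> simp
  ring

open scoped ComplexOrder MatrixOrder in
lemma posDef_ofReal_map {Y : Matrix (Fin n) (Fin n) ℝ} (hY : Y.PosDef) :
    (Y.map Complex.ofReal).PosDef := by
  obtain ⟨B, hB⟩ := CStarAlgebra.nonneg_iff_eq_star_mul_self.mp hY.posSemidef.nonneg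
  have hu : IsUnit (star B * B) := hB ▸ hY.isUnit
  have hBu : IsUnit B := by
    rw [Matrix.isUnit_iff_isUnit_det, det_mul] at hu
    exact (Matrix.isUnit_iff_isUnit_det _).2 (isUnit_of_mul_isUnit_right hu)
  have hBc : IsUnit (B.map Complex.ofReal) := hBu.map Complex.ofRealHom.mapMatrix
  have e : Y.map Complex.ofReal = (B.map Complex.ofReal)ᴴ * B.map Complex.ofReal := by
    rw [conjTranspose_ofReal_map, hB, star_eq_conjTranspose, conjTranspose_eq_transpose_of_trivial]
    exact Matrix.map_mul (f := Complex.ofRealHom)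
  rw [e]
  exact PosDef.conjTranspose_mul_self _ (mulVec_injective_iff_isUnit.2 hBc)

open scoped ComplexOrder in
lemma posDef_of_ofReal_map {Y : Matrix (Fin n) (Fin n) ℝ} (hY : (Y.map Complex.ofReal).PosDef) :
    Y.PosDef := by
  refine PosDef.of_dotProduct_mulVec_pos ?_ fun x hx => ?_
  · ext i j
    have := hY.1.apply i j
    simpa using this
  · have hx' : (fun i => (x i : ℂ)) ≠ 0 := fun h => hx (by
      ext i
      simpa using congrFun h i)
    have := hY.dotProduct_mulVec_pos hx'
    have e : star (fun i => (x i : ℂ)) ⬝ᵥ Y.map Complex.ofReal *ᵥ (fun i => (x i : ℂ)) =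
        ((star x ⬝ᵥ Y *ᵥ x : ℝ) : ℂ) := by
      simp [dotProduct, mulVec]
    rw [e] at this
    exact_mod_cast this

open scoped ComplexOrder in
lemma isUnit_denomMatrix (g : symplecticGroup (Fin n) ℝ) (Z : siegelUpperHalfSpace n) :
    IsUnit (denomMatrix g Z) := by
  by_contra h
  obtain ⟨a, ha, ha2⟩ : ∃ a ≠ 0, denomMatrix g Z *ᵥ a = 0 := by
    obtain ⟨a, b, ha⟩ := Function.not_injective_iff.mp <| mulVec_injective_iff_isUnit.not.mpr h
    exact ⟨a - b, sub_ne_zero.2 ha.2, by rw [mulVec_sub, ha.1, sub_self]⟩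
  have hpos := (posDef_ofReal_map Z.2.2).dotProduct_mulVec_pos ha
  have hrel := denom_conjTranspose_relation g Z
  rw [sub_conjTranspose_of_isSymm Z.2.1] at hrel
  have h0 := congrArg (fun M => star a ⬝ᵥ M *ᵥ a) hrel
  simp only [sub_mulVec, ← mulVec_mulVec, ha2, mulVec_zero, sub_zero, smul_mulVec,
    dotProduct_smul, smul_eq_mul] at h0
  rw [dotProduct_mulVec, ← star_mulVec, ha2, star_zero, zero_dotProduct] at h0
  have h2I : (2 * Complex.I : ℂ) ≠ 0 := by simp
  exact hpos.ne (mul_left_cancel₀ h2I (by rw [mul_zero]; exact h0))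

/-- `J(g, Z) = CZ + D` as an element of `GL_n(ℂ)`. -/
def automorphyFactor (g : symplecticGroup (Fin n) ℝ) (Z : siegelUpperHalfSpace n) :
    GL (Fin n) ℂ :=
  (isUnit_denomMatrix g Z).unit

open scoped ComplexOrder in
lemma moebius_mem (g : symplecticGroup (Fin n) ℝ) (Z : siegelUpperHalfSpace n) :
    numMatrix g Z * (denomMatrix g Z)⁻¹ ∈ siegelUpperHalfSpace n := by
  have hu : IsUnit (denomMatrix g Z).det := (isUnit_iff_isUnit_det _).1 (isUnit_denomMatrix g Z)
  have hsymm : (numMatrix g Z * (denomMatrix g Z)⁻¹).IsSymm := by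
    have h := transpose_num_mul_denom g Z
    have hut : IsUnit (denomMatrix g Z)ᵀ.det := by rwa [det_transpose]
    rw [IsSymm, transpose_mul, transpose_nonsing_inv]
    calc (denomMatrix g Z)ᵀ⁻¹ * (numMatrix g Z)ᵀ
        = (denomMatrix g Z)ᵀ⁻¹ * ((numMatrix g Z)ᵀ * denomMatrix g Z) * (denomMatrix g Z)⁻¹ := by
          rw [Matrix.mul_assoc, mul_nonsing_inv_cancel_right _ _ hu]
      _ = numMatrix g Z * (denomMatrix g Z)⁻¹ := by
          rw [h, nonsing_inv_mul_cancel_left _ _ hut]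
  refine ⟨hsymm, posDef_of_ofReal_map ?_⟩
  have hrel := denom_conjTranspose_relation g Z
  rw [sub_conjTranspose_of_isSymm Z.2.1] at hrel
  have hW := sub_conjTranspose_of_isSymm hsymm
  have huc : IsUnit (denomMatrix g Z)ᴴ.det := by
    rw [det_conjTranspose]
    exact hu.star
  have e : numMatrix g Z * (denomMatrix g Z)⁻¹ - (numMatrix g Z * (denomMatrix g Z)⁻¹)ᴴ =
      ((denomMatrix g Z)⁻¹)ᴴ * ((denomMatrix g Z)ᴴ * numMatrix g Z -
        (numMatrix g Z)ᴴ * denomMatrix g Z) * (denomMatrix g Z)⁻¹ := by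
    rw [conjTranspose_mul, conjTranspose_nonsing_inv, Matrix.mul_sub, Matrix.sub_mul,
      nonsing_inv_mul_cancel_left _ _ huc, ← Matrix.mul_assoc,
      mul_nonsing_inv_cancel_right _ _ hu]
  rw [hW, hrel, Matrix.mul_smul, Matrix.smul_mul] at e
  have h2I : (2 * Complex.I : ℂ) ≠ 0 := by simp
  have e' := smul_right_injective _ h2I e
  rw [e']
  exact (posDef_ofReal_map Z.2.2).conjTranspose_mul_mul_same (mulVec_injective_iff_isUnit.2
    ((isUnit_nonsing_inv_iff).2 (isUnit_denomMatrix g Z)))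

/-- The action `gZ = (AZ + B)(CZ + D)⁻¹` of `Sp_{2n}(ℝ)` on the Siegel upper half space. -/
def moebius (g : symplecticGroup (Fin n) ℝ) (Z : siegelUpperHalfSpace n) :
    siegelUpperHalfSpace n :=
  ⟨numMatrix g Z * (denomMatrix g Z)⁻¹, moebius_mem g Z⟩

open scoped MatrixOrder in
lemma isUnit_sqrt_imPart (Z : siegelUpperHalfSpace n) :
    IsUnit ((CFC.sqrt (imPart Z)).map Complex.ofReal) := by
  have hY : (imPart Z).PosDef := Z.2.2
  have hu : IsUnit (CFC.sqrt (imPart Z) * CFC.sqrt (imPart Z)) := by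
    rw [CFC.sqrt_mul_sqrt_self _ hY.posSemidef.nonneg]
    exact hY.isUnit
  have hs : IsUnit (CFC.sqrt (imPart Z)) := by
    rw [Matrix.isUnit_iff_isUnit_det, det_mul] at hu
    exact (Matrix.isUnit_iff_isUnit_det _).2 (isUnit_of_mul_isUnit_right hu)
  exact hs.map Complex.ofRealHom.mapMatrix

open scoped MatrixOrder in
/-- The positive definite square root `Y^{1/2}` of the imaginary part `Y` of `Z`, as an element
of `GL_n(ℂ)`. -/
def sqrtImPart (Z : siegelUpperHalfSpace n) : GL (Fin n) ℂ :=
  (isUnit_sqrt_imPart Z).unit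

end Action

/-! ### Nearly holomorphic functions and Fourier expansions -/

/-- The index set `{(i, j) : i ≤ j}` of the entries of a symmetric `n × n` matrix. -/
abbrev UpperIndex (n : ℕ) : Type := {ij : Fin n × Fin n // ij.1 ≤ ij.2}

/-- The exponents `b = (b_{i,j})_{i ≤ j}` of natural numbers with `∑ b_{i,j} ≤ p`. -/
def boundedExponents (n p : ℕ) : Finset (UpperIndex n → ℕ) :=
  (Fintype.piFinset fun _ => Finset.range (p + 1)).filter fun b => ∑ ij, b ij ≤ p

lemma mem_boundedExponents {n p : ℕ} {b : UpperIndex n → ℕ} :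
    b ∈ boundedExponents n p ↔ ∑ ij, b ij ≤ p := by
  simp only [boundedExponents, Finset.mem_filter, Fintype.mem_piFinset, Finset.mem_range,
    and_iff_right_iff_imp]
  intro h ij
  have := Finset.single_le_sum (f := b) (fun _ _ => Nat.zero_le _) (Finset.mem_univ ij)
  omega

/-- The monomial `[V]^b = ∏_{i ≤ j} v_{i,j}^{b_{i,j}}` in the entries of a symmetric matrix. -/
def matrixMonomial {n : ℕ} (V : Matrix (Fin n) (Fin n) ℝ) (b : UpperIndex n → ℕ) : ℝ :=
  ∏ ij, V ij.1.1 ij.1.2 ^ b ij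

/-- `N^p(H_n)`: polynomials in the entries of `Y⁻¹` of total degree at most `p` whose
coefficients are holomorphic functions on `H_n`.  Since `H_n` is an open subset of the complex
subspace of symmetric matrices, `DifferentiableOn ℂ _ H_n`, where only increments within `H_n` are
considered, means complex differentiability as a function on this open set of symmetric
matrices. -/
def IsNearlyHolomorphic {n : ℕ} (p : ℕ) (f : siegelUpperHalfSpace n → ℂ) : Prop :=
  ∃ G : (UpperIndex n → ℕ) → Matrix (Fin n) (Fin n) ℂ → ℂ,
    (∀ b ∈ boundedExponents n p, DifferentiableOn ℂ (G b) (siegelUpperHalfSpace n)) ∧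
    ∀ Z : siegelUpperHalfSpace n,
      f Z = ∑ b ∈ boundedExponents n p, G b Z * (matrixMonomial (imPart Z)⁻¹ b : ℂ)

/-- The positive semidefinite matrices in `(1/N) M_n^{sym}(ℤ)`. -/
def fourierIndex (n N : ℕ) : Set (Matrix (Fin n) (Fin n) ℝ) :=
  {S | S.PosSemidef ∧ ∃ T : Matrix (Fin n) (Fin n) ℤ,
    T.IsSymm ∧ S = (1 / (N : ℝ)) • T.map (Int.cast : ℤ → ℝ)}

/-- The term `a · e^{2πi Tr(SZ)} [Y⁻¹]^b` of a Fourier expansion. -/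
def fourierTerm {n : ℕ} (a : ℂ) (b : UpperIndex n → ℕ) (S : Matrix (Fin n) (Fin n) ℝ)
    (Z : siegelUpperHalfSpace n) : ℂ :=
  a * Complex.exp (2 * Real.pi * Complex.I *
      (S.map Complex.ofReal * (Z : Matrix (Fin n) (Fin n) ℂ)).trace) *
    (matrixMonomial (imPart Z)⁻¹ b : ℂ)

/-- `f` has a nice Fourier expansion
`f(Z) = ∑_{b} ∑_{S ≥ 0} a_b(f, S) e^{2πi Tr(SZ)} [Y⁻¹]^b`,
with `S` running over the positive semidefinite elements of `(1/N) M_n^{sym}(ℤ)` for some positive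
integer `N`, which converges absolutely and uniformly on compact subsets of `H_n`. -/
def HasNiceFourierExpansion {n : ℕ} (p : ℕ) (f : siegelUpperHalfSpace n → ℂ) : Prop :=
  ∃ N : ℕ, 0 < N ∧ ∃ a : (UpperIndex n → ℕ) → Matrix (Fin n) (Fin n) ℝ → ℂ,
    (∀ Z : siegelUpperHalfSpace n,
      Summable fun bS : boundedExponents n p × fourierIndex n N =>
        ‖fourierTerm (a bS.1 bS.2) bS.1 bS.2 Z‖) ∧
    ∀ K : Set (siegelUpperHalfSpace n), IsCompact K →
      HasSumUniformlyOn
        (fun (bS : boundedExponents n p × fourierIndex n N) (Z : siegelUpperHalfSpace n) =>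
          fourierTerm (a bS.1 bS.2) bS.1 bS.2 Z) f K

/-! ### Congruence subgroups -/

/-- `Sp_{2n}(ℤ)` as a subgroup of `Sp_{2n}(ℚ)`. -/
def integralSp (n : ℕ) : Subgroup (symplecticGroup (Fin n) ℚ) :=
  (spMap n (Int.castRingHom ℚ)).range

/-- The principal congruence subgroup of level `N` of `Sp_{2n}(ℤ)`, inside `Sp_{2n}(ℚ)`: integral
symplectic matrices congruent to `1` modulo `N`. -/
def principalCongruence (n N : ℕ) : Subgroup (symplecticGroup (Fin n) ℚ) :=
  (spMap n (Int.castRingHom (ZMod N))).ker.map (spMap n (Int.castRingHom ℚ))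

/-- A congruence subgroup of `Sp_{2n}(ℚ)` is a subgroup commensurable with `Sp_{2n}(ℤ)` which
contains a principal congruence subgroup. -/
def IsCongruenceSubgroup {n : ℕ} (Γ : Subgroup (symplecticGroup (Fin n) ℚ)) : Prop :=
  Γ.Commensurable (integralSp n) ∧ ∃ N : ℕ, 0 < N ∧ principalCongruence n N ≤ Γ

/-! ### Representations of `GL_n(ℂ)` and nearly holomorphic Siegel modular forms -/

section Forms

variable {n : ℕ} {V : Type*} [AddCommGroup V] [Module ℂ V]

/-- A representation of `GL_n(ℂ)` is rational if all its matrix coefficients are polynomials in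
the entries of `g` divided by powers of `det g`. -/
def IsRational (ρ : Representation ℂ (GL (Fin n) ℂ) V) : Prop :=
  ∀ (L : V →ₗ[ℂ] ℂ) (v : V), ∃ (P : MvPolynomial (Fin n × Fin n) ℂ) (k : ℕ),
    ∀ g : GL (Fin n) ℂ,
      L (ρ g v) = MvPolynomial.eval (fun ij => (g : Matrix (Fin n) (Fin n) ℂ) ij.1 ij.2) P /
        (g : Matrix (Fin n) (Fin n) ℂ).det ^ k

/-- `lam` is the highest weight of the (irreducible) representation `ρ`: there is a nonzero vector
on which the upper triangular matrices act through the character `b ↦ ∏ b_{ii}^{lam_i}`. -/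
def IsHighestWeight (ρ : Representation ℂ (GL (Fin n) ℂ) V) (lam : Fin n → ℕ) : Prop :=
  ∃ v : V, v ≠ 0 ∧ ∀ b : GL (Fin n) ℂ,
    (b : Matrix (Fin n) (Fin n) ℂ).BlockTriangular id →
      ρ b v = (∏ i, (b : Matrix (Fin n) (Fin n) ℂ) i i ^ lam i) • v

/-- The slash action `(F|_ρ g)(Z) = ρ(J(g, Z))⁻¹ F(gZ)`. -/
def slash (ρ : Representation ℂ (GL (Fin n) ℂ) V) (F : siegelUpperHalfSpace n → V)
    (g : symplecticGroup (Fin n) ℝ) : siegelUpperHalfSpace n → V :=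
  fun Z => ρ (automorphyFactor g Z)⁻¹ (F (moebius g Z))

/-- The slash action of a rational symplectic matrix. -/
def slashRat (ρ : Representation ℂ (GL (Fin n) ℂ) V) (F : siegelUpperHalfSpace n → V)
    (g : symplecticGroup (Fin n) ℚ) : siegelUpperHalfSpace n → V :=
  slash ρ F (spMap n (algebraMap ℚ ℝ) g)

/-- Membership in `N^p_ρ(Γ)`. -/
structure IsNearlyHolomorphicForm (ρ : Representation ℂ (GL (Fin n) ℂ) V) (p : ℕ)
    (Γ : Subgroup (symplecticGroup (Fin n) ℚ)) (F : siegelUpperHalfSpace n → V) : Prop where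
  nearlyHolomorphic : ∀ (g : symplecticGroup (Fin n) ℚ) (L : V →ₗ[ℂ] ℂ),
    IsNearlyHolomorphic p (fun Z => L (slashRat ρ F g Z)) ∧
      HasNiceFourierExpansion p (fun Z => L (slashRat ρ F g Z))
  slash_eq : ∀ γ ∈ Γ, slashRat ρ F γ = F

/-- `N_ρ^{(n)}`: all nearly holomorphic Siegel modular forms of weight `ρ`, for all congruence
subgroups and all degrees `p`. -/
def nearlyHolomorphicForms (ρ : Representation ℂ (GL (Fin n) ℂ) V) :
    Set (siegelUpperHalfSpace n → V) :=
  {F | ∃ Γ : Subgroup (symplecticGroup (Fin n) ℚ), IsCongruenceSubgroup Γ ∧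
    ∃ p : ℕ, IsNearlyHolomorphicForm ρ p Γ F}

end Forms

end NearlyHolomorphicSiegel

end

noncomputable section

namespace NearlyHolomorphicSiegel

open Matrix

section Action

variable {n : ℕ}

/-! ### The action of the symplectic group -/

/-! The function `‖ρ(Y^{1/2})F(Z)‖` is an invariant norm: by `norm_sqrtImPart_slash`, its value for
`F|g` at `Z` is its value for `F` at `gZ`. Since `Γ` meets `Sp_{2n}(ℤ)` in finite index, only
finitely many translates `F|t` matter, and it suffices to estimate them at a point `W = gZ` with `Im
W ≥ c`, which exists in every integral orbit (`exists_moebius_imPart_ge`).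

On that region two facts combine. A nice Fourier expansion is dominated term by term by its values
at a single point, so the coordinates of `F|t` are bounded (`HasNiceFourierExpansion.bounded`). And
`ρ(s)w = O(|det s|^{λ₁})` as long as `s⁻¹` stays bounded: for the highest weight vector this follows
from the QR decomposition, and such vectors form a subrepresentation, which irreducibility makes
everything (`hasDetGrowth_of_irreducible`). Hence the norm at `Z` is `O(det(Im gZ)^{λ₁/2})`.

It remains to bound the height `det(Im gZ)` over integral `g` by `K²/det Y` with `K = n!(2(1 + Tr
Y))^n` (`det_imPart_moebius_le`). The input is the polarized identity `J(g,Z)^*(g(i) - (gZ)^*)J(g,i)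
= i - Z^*` together with `|det J(g,i)| ≥ 1`. The same bound makes heights in an orbit bounded above,
and this starts the reduction theory: at almost maximal height, inversions in one coordinate force
all diagonal entries of `UᵀYU` to be at least `1/2`, and a Hermite-type induction
(`hasReduction_fin`) turns this into a lower bound for the whole form. Near-extremal points suffice
throughout, so no extremum has to be attained. -/

lemma isUnit_det_denomMatrix (g : symplecticGroup (Fin n) ℝ) (Z : siegelUpperHalfSpace n) :
    IsUnit (denomMatrix g Z).det :=
  (isUnit_iff_isUnit_det _).1 (isUnit_denomMatrix g Z)

lemma coe_moebius (g : symplecticGroup (Fin n) ℝ) (Z : siegelUpperHalfSpace n) :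
    (moebius g Z : Matrix (Fin n) (Fin n) ℂ) = numMatrix g Z * (denomMatrix g Z)⁻¹ := rfl

lemma moebius_mul_denomMatrix (g : symplecticGroup (Fin n) ℝ) (Z : siegelUpperHalfSpace n) :
    (moebius g Z : Matrix (Fin n) (Fin n) ℂ) * denomMatrix g Z = numMatrix g Z := by
  rw [coe_moebius, nonsing_inv_mul_cancel_right _ _ (isUnit_det_denomMatrix g Z)]

lemma toBlocks_mul (M N : Matrix (Fin n ⊕ Fin n) (Fin n ⊕ Fin n) ℝ) :
    (M * N).toBlocks₁₁ = M.toBlocks₁₁ * N.toBlocks₁₁ + M.toBlocks₁₂ * N.toBlocks₂₁ ∧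
    (M * N).toBlocks₁₂ = M.toBlocks₁₁ * N.toBlocks₁₂ + M.toBlocks₁₂ * N.toBlocks₂₂ ∧
    (M * N).toBlocks₂₁ = M.toBlocks₂₁ * N.toBlocks₁₁ + M.toBlocks₂₂ * N.toBlocks₂₁ ∧
    (M * N).toBlocks₂₂ = M.toBlocks₂₁ * N.toBlocks₁₂ + M.toBlocks₂₂ * N.toBlocks₂₂ := by
  conv in (occs := 1 2 3 4) M * N => all_goals
    rw [← fromBlocks_toBlocks M, ← fromBlocks_toBlocks N, fromBlocks_multiply]
  simp

lemma map_ofReal_mul (A B : Matrix (Fin n) (Fin n) ℝ) :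
    (A * B).map Complex.ofReal = A.map Complex.ofReal * B.map Complex.ofReal :=
  Matrix.map_mul (f := Complex.ofRealHom)

lemma map_ofReal_add (A B : Matrix (Fin n) (Fin n) ℝ) :
    (A + B).map Complex.ofReal = A.map Complex.ofReal + B.map Complex.ofReal :=
  Matrix.map_add _ Complex.ofReal_add A B

lemma denomMatrix_mul (g h : symplecticGroup (Fin n) ℝ) (Z : siegelUpperHalfSpace n) :
    denomMatrix (g * h) Z = denomMatrix g (moebius h Z) * denomMatrix h Z := by
  obtain ⟨-, -, h3, h4⟩ := toBlocks_mul g.1 h.1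
  conv_rhs => rw [denomMatrix, Matrix.add_mul, Matrix.mul_assoc, moebius_mul_denomMatrix]
  rw [denomMatrix, denomMatrix, numMatrix, Submonoid.coe_mul, h3, h4]
  simp only [map_ofReal_mul, map_ofReal_add]
  noncomm_ring

lemma numMatrix_mul (g h : symplecticGroup (Fin n) ℝ) (Z : siegelUpperHalfSpace n) :
    numMatrix (g * h) Z = numMatrix g (moebius h Z) * denomMatrix h Z := by
  obtain ⟨h1, h2, -, -⟩ := toBlocks_mul g.1 h.1
  conv_rhs => rw [numMatrix, Matrix.add_mul, Matrix.mul_assoc, moebius_mul_denomMatrix]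
  rw [denomMatrix, numMatrix, numMatrix, Submonoid.coe_mul, h1, h2]
  simp only [map_ofReal_mul, map_ofReal_add]
  noncomm_ring

lemma moebius_mul (g h : symplecticGroup (Fin n) ℝ) (Z : siegelUpperHalfSpace n) :
    moebius (g * h) Z = moebius g (moebius h Z) := by
  apply Subtype.ext
  rw [coe_moebius, coe_moebius, denomMatrix_mul, numMatrix_mul, Matrix.mul_inv_rev,
    ← Matrix.mul_assoc, mul_nonsing_inv_cancel_right _ _ (isUnit_det_denomMatrix h Z)]

lemma moebius_eq_of_num_eq {g : symplecticGroup (Fin n) ℝ} {Z : siegelUpperHalfSpace n}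
    {W : Matrix (Fin n) (Fin n) ℂ} (h : numMatrix g Z = W * denomMatrix g Z) :
    (moebius g Z : Matrix (Fin n) (Fin n) ℂ) = W := by
  rw [coe_moebius, h, mul_nonsing_inv_cancel_right _ _ (isUnit_det_denomMatrix g Z)]

lemma moebius_one (Z : siegelUpperHalfSpace n) : moebius 1 Z = Z := by
  apply Subtype.ext
  apply moebius_eq_of_num_eq
  rw [numMatrix, denomMatrix, OneMemClass.coe_one, ← fromBlocks_one]
  simp [-fromBlocks_one]

/-- The polarized form of the transformation law of the imaginary part. -/
lemma denomMatrix_conj_sub (g : symplecticGroup (Fin n) ℝ) (Z W : siegelUpperHalfSpace n) :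
    (denomMatrix g Z)ᴴ * ((moebius g W : Matrix (Fin n) (Fin n) ℂ) -
        (moebius g Z : Matrix (Fin n) (Fin n) ℂ)ᴴ) * denomMatrix g W =
      (W : Matrix (Fin n) (Fin n) ℂ) - (Z : Matrix (Fin n) (Fin n) ℂ)ᴴ := by
  have e : (denomMatrix g Z)ᴴ * ((moebius g W : Matrix (Fin n) (Fin n) ℂ) -
        (moebius g Z : Matrix (Fin n) (Fin n) ℂ)ᴴ) * denomMatrix g W =
      (denomMatrix g Z)ᴴ * numMatrix g W - (numMatrix g Z)ᴴ * denomMatrix g W := by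
    rw [Matrix.mul_sub, Matrix.sub_mul, Matrix.mul_assoc, moebius_mul_denomMatrix,
      ← conjTranspose_mul, moebius_mul_denomMatrix]
  rw [e]
  obtain ⟨h1, h2, h3⟩ := block_relations g
  have h3' := congrArg Matrix.transpose h3
  simp only [transpose_sub, transpose_mul, transpose_transpose, transpose_one] at h3'
  unfold numMatrix denomMatrix
  simp only [conjTranspose_add, conjTranspose_mul, conjTranspose_ofReal_map]
  generalize g.1.toBlocks₁₁.map Complex.ofReal = A at *
  generalize g.1.toBlocks₁₂.map Complex.ofReal = B at *
  generalize g.1.toBlocks₂₁.map Complex.ofReal = C at *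
  generalize g.1.toBlocks₂₂.map Complex.ofReal = D at *
  generalize (Z : Matrix (Fin n) (Fin n) ℂ) = S at *
  generalize (W : Matrix (Fin n) (Fin n) ℂ) = W at *
  have e : (Sᴴ * Cᵀ + Dᵀ) * (A * W + B) - (Sᴴ * Aᵀ + Bᵀ) * (C * W + D) =
      -(Sᴴ * (Aᵀ * C - Cᵀ * A) * W) - (Bᵀ * D - Dᵀ * B) - Sᴴ * (Aᵀ * D - Cᵀ * B)
        + (Dᵀ * A - Bᵀ * C) * W := by noncomm_ring
  rw [e, h1, h2, h3, h3']
  simp [sub_eq_neg_add]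

/-- The diagonal case of the polarized identity, where both differences are `2i` times imaginary
parts. -/
lemma denomMatrix_conj_imPart (g : symplecticGroup (Fin n) ℝ) (Z : siegelUpperHalfSpace n) :
    (denomMatrix g Z)ᴴ * (imPart (moebius g Z)).map Complex.ofReal * denomMatrix g Z =
      (imPart Z).map Complex.ofReal := by
  have h := denomMatrix_conj_sub g Z Z
  rw [sub_conjTranspose_of_isSymm Z.2.1, sub_conjTranspose_of_isSymm (moebius g Z).2.1,
    Matrix.mul_smul, Matrix.smul_mul] at h
  exact smul_right_injective _ (by simp : (2 * Complex.I : ℂ) ≠ 0) h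

lemma det_map_ofReal (A : Matrix (Fin n) (Fin n) ℝ) :
    (A.map Complex.ofReal).det = (A.det : ℂ) :=
  (RingHom.map_det Complex.ofRealHom A).symm

lemma det_imPart_pos (Z : siegelUpperHalfSpace n) : 0 < (imPart Z).det := Z.2.2.det_pos

lemma norm_det_denomMatrix_pos (g : symplecticGroup (Fin n) ℝ) (Z : siegelUpperHalfSpace n) :
    0 < ‖(denomMatrix g Z).det‖ :=
  norm_pos_iff.2 (isUnit_det_denomMatrix g Z).ne_zero

lemma det_imPart_moebius (g : symplecticGroup (Fin n) ℝ) (Z : siegelUpperHalfSpace n) :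
    (imPart (moebius g Z)).det * ‖(denomMatrix g Z).det‖ ^ 2 = (imPart Z).det := by
  have h := congrArg (fun M => ‖Matrix.det M‖) (denomMatrix_conj_imPart g Z)
  simp only [det_mul, det_conjTranspose, det_map_ofReal, norm_mul, norm_star, Complex.norm_real,
    Real.norm_of_nonneg (det_imPart_pos _).le] at h
  rw [← h]
  ring

/-! ### Integral symplectic matrices -/

/-- An integral symplectic matrix as a real symplectic matrix. -/
abbrev ofInt (g : symplecticGroup (Fin n) ℤ) : symplecticGroup (Fin n) ℝ :=
  spMap n (Int.castRingHom ℝ) g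

/-- Translation by a symmetric integral matrix. -/
def translation (S : Matrix (Fin n) (Fin n) ℤ) (hS : S.IsSymm) : symplecticGroup (Fin n) ℤ :=
  ⟨fromBlocks 1 S 0 1, by rw [SymplecticGroup.fromBlocks_mem_iff]; simp [hS.eq]⟩

/-- The symplectic matrix acting by `Z ↦ Uᵀ Z U`. -/
def levi (U : Matrix (Fin n) (Fin n) ℤ) (hU : IsUnit U.det) : symplecticGroup (Fin n) ℤ :=
  ⟨fromBlocks Uᵀ 0 0 U⁻¹, by
    rw [SymplecticGroup.fromBlocks_mem_iff]; simp [mul_nonsing_inv _ hU]⟩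

/-- The inversion `z ↦ -1/z` in the coordinate `i`. -/
def partialInversion (i : Fin n) : symplecticGroup (Fin n) ℤ :=
  ⟨fromBlocks (1 - single i i 1) (-single i i 1) (single i i 1) (1 - single i i 1), by
    rw [SymplecticGroup.fromBlocks_mem_iff]
    simp [Matrix.mul_sub, Matrix.sub_mul]⟩

lemma coe_moebius_translation (S : Matrix (Fin n) (Fin n) ℤ) (hS : S.IsSymm)
    (Z : siegelUpperHalfSpace n) :
    (moebius (ofInt (translation S hS)) Z : Matrix (Fin n) (Fin n) ℂ) =
      (Z : Matrix (Fin n) (Fin n) ℂ) + S.map (Int.cast : ℤ → ℂ) := by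
  apply moebius_eq_of_num_eq
  ext i j
  simp [numMatrix, denomMatrix, ofInt, spMap, translation, fromBlocks_map, Matrix.map_map]

lemma imPart_moebius_translation (S : Matrix (Fin n) (Fin n) ℤ) (hS : S.IsSymm)
    (Z : siegelUpperHalfSpace n) :
    imPart (moebius (ofInt (translation S hS)) Z) = imPart Z := by
  ext i j
  simp [imPart, coe_moebius_translation]

lemma coe_moebius_levi (U : Matrix (Fin n) (Fin n) ℤ) (hU : IsUnit U.det)
    (Z : siegelUpperHalfSpace n) :
    (moebius (ofInt (levi U hU)) Z : Matrix (Fin n) (Fin n) ℂ) =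
      (U.map (Int.cast : ℤ → ℂ))ᵀ * (Z : Matrix (Fin n) (Fin n) ℂ) * U.map (Int.cast : ℤ → ℂ) := by
  apply moebius_eq_of_num_eq
  have h : U.map (Int.cast : ℤ → ℂ) * (U⁻¹).map (Int.cast : ℤ → ℂ) = 1 := by
    have := congrArg (fun M : Matrix (Fin n) (Fin n) ℤ => M.map (Int.castRingHom ℂ))
      (mul_nonsing_inv _ hU)
    rw [Matrix.map_mul] at this
    simpa using this
  have h2 : denomMatrix (ofInt (levi U hU)) Z = (U⁻¹).map (Int.cast : ℤ → ℂ) := by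
    ext i j
    simp [denomMatrix, ofInt, spMap, levi, fromBlocks_map, Matrix.map_map]
  rw [h2, Matrix.mul_assoc, h, Matrix.mul_one]
  have h3 : (U.transpose.map (Int.cast : ℤ → ℝ)).map Complex.ofReal =
    (U.map (Int.cast : ℤ → ℂ))ᵀ := by ext; simp
  simp [numMatrix, ofInt, spMap, levi, fromBlocks_map, ← h3]

lemma imPart_moebius_levi (U : Matrix (Fin n) (Fin n) ℤ) (hU : IsUnit U.det)
    (Z : siegelUpperHalfSpace n) :
    imPart (moebius (ofInt (levi U hU)) Z) =
      (U.map (Int.cast : ℤ → ℝ))ᵀ * imPart Z * U.map (Int.cast : ℤ → ℝ) := by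
  ext i j
  simp [imPart, coe_moebius_levi, Matrix.mul_apply]

/-- The matrix `CZ + D` is here the identity with row `i` replaced by that of `Z`. Almost maximality
of the height thereby becomes a lower bound for `|Z i i|`. -/
lemma det_denomMatrix_partialInversion (i : Fin n) (Z : siegelUpperHalfSpace n) :
    (denomMatrix (ofInt (partialInversion i)) Z).det = (Z : Matrix (Fin n) (Fin n) ℂ) i i := by
  have h : denomMatrix (ofInt (partialInversion i)) Z =
      updateRow 1 i ((Z : Matrix (Fin n) (Fin n) ℂ) i) := by
    ext k j
    by_cases hk : k = i
    · subst hk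
      by_cases hj : j = k
      · subst hj
        simp [denomMatrix, ofInt, spMap, partialInversion, fromBlocks_map, Matrix.mul_apply,
          single_apply, apply_ite Complex.ofReal]
      · simp [denomMatrix, ofInt, spMap, partialInversion, fromBlocks_map, Matrix.mul_apply,
          single_apply, Ne.symm hj, one_apply, apply_ite Complex.ofReal]
    · simp [denomMatrix, ofInt, spMap, partialInversion, fromBlocks_map, Matrix.mul_apply,
        Ne.symm hk, one_apply, hk, updateRow_apply, apply_ite Complex.ofReal]
  rw [h, ← cramer_transpose_apply]
  simp

end Action

section Height

variable {n : ℕ}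

/-! ### An upper bound for the height of integral translates -/

lemma one_le_norm_det_of_one_le_norm_eigenvalues {M : Matrix (Fin n) (Fin n) ℂ}
    (h : ∀ (z : ℂ) (v : Fin n → ℂ), v ≠ 0 → M *ᵥ v = z • v → 1 ≤ ‖z‖) : 1 ≤ ‖M.det‖ := by
  rw [det_eq_prod_roots_charpoly]
  have key : ∀ z ∈ M.charpoly.roots, 1 ≤ ‖z‖ := by
    intro z hz
    rw [Polynomial.mem_roots (charpoly_monic M).ne_zero, Polynomial.IsRoot.def, eval_charpoly] at hz
    obtain ⟨v, hv, hv2⟩ := exists_mulVec_eq_zero_iff.2 hz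
    refine h z v hv ?_
    rw [sub_mulVec, sub_eq_zero] at hv2
    rw [← hv2]
    simp [← smul_one_eq_diagonal, scalar_apply, smul_mulVec]
  generalize M.charpoly.roots = s at key
  induction s using Multiset.induction_on with
  | empty => simp
  | cons a s ih =>
    rw [Multiset.prod_cons, norm_mul]
    exact one_le_mul_of_one_le_of_one_le (key a (Multiset.mem_cons_self a s))
      (ih fun z hz => key z (Multiset.mem_cons_of_mem hz))

-- Let `P`, `Q` be the imaginary parts of `Z`, `W` and `D = W - Z^*`, so that `D - D^* = 2i(P + Q)`.
-- If `Dv = zPv`, pairing with `v` gives `Im z = 1 + (v^*Qv)/(v^*Pv) ≥ 1`. All eigenvalues of `P⁻¹D`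
-- thus have modulus at least `1`, hence so does its determinant.
open scoped ComplexOrder in
lemma det_imPart_le_norm_det_sub (Z W : siegelUpperHalfSpace n) :
    (imPart Z).det ≤
      ‖((W : Matrix (Fin n) (Fin n) ℂ) - (Z : Matrix (Fin n) (Fin n) ℂ)ᴴ).det‖ := by
  set P := (imPart Z).map Complex.ofReal with hP
  set Q := (imPart W).map Complex.ofReal with hQ
  set D := (W : Matrix (Fin n) (Fin n) ℂ) - (Z : Matrix (Fin n) (Fin n) ℂ)ᴴ with hD
  have hPpos : P.PosDef := posDef_ofReal_map Z.2.2
  have hQpos : Q.PosDef := posDef_ofReal_map W.2.2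
  have hPu : IsUnit P.det := (isUnit_iff_isUnit_det _).1 hPpos.isUnit
  have hDD : D - Dᴴ = (2 * Complex.I) • (P + Q) := by
    rw [smul_add, hP, hQ, imPart, imPart, ← sub_conjTranspose_of_isSymm Z.2.1,
      ← sub_conjTranspose_of_isSymm W.2.1, hD, conjTranspose_sub, conjTranspose_conjTranspose]
    abel
  have h1 : 1 ≤ ‖(P⁻¹ * D).det‖ := by
    refine one_le_norm_det_of_one_le_norm_eigenvalues fun z v hv hz => ?_
    have hDv : D *ᵥ v = z • (P *ᵥ v) := by
      rw [← mulVec_smul, ← hz, mulVec_mulVec, mul_nonsing_inv_cancel_left _ _ hPu]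
    have e := congrArg (fun M => star v ⬝ᵥ M *ᵥ v) hDD
    simp only [sub_mulVec, smul_mulVec, add_mulVec, dotProduct_sub, dotProduct_smul,
      dotProduct_add] at e
    rw [dotProduct_mulVec (star v) Dᴴ, ← star_mulVec, hDv, star_smul, dotProduct_smul,
      smul_dotProduct, star_mulVec, hPpos.1.eq, ← dotProduct_mulVec] at e
    have hp := hPpos.dotProduct_mulVec_pos hv
    have hq := hQpos.dotProduct_mulVec_pos hv
    generalize star v ⬝ᵥ P *ᵥ v = p at *
    generalize star v ⬝ᵥ Q *ᵥ v = q at *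
    rw [Complex.lt_def] at hp hq
    have e2 := congrArg Complex.im e
    simp only [smul_eq_mul, Complex.sub_im, Complex.mul_im, Complex.star_def, Complex.conj_re,
      Complex.conj_im, Complex.add_re, Complex.add_im, Complex.mul_re, Complex.I_re, Complex.I_im,
      Complex.re_ofNat, Complex.im_ofNat] at e2
    obtain ⟨hp1, hp2⟩ := hp
    obtain ⟨hq1, hq2⟩ := hq
    simp only [Complex.zero_re, Complex.zero_im] at hp1 hp2 hq1 hq2
    rw [← hp2, ← hq2] at e2
    have h3 : 1 ≤ z.im := by nlinarith
    exact h3.trans ((le_abs_self _).trans (Complex.abs_im_le_norm z))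
  rw [det_mul, det_nonsing_inv, Ring.inverse_eq_inv', norm_mul, norm_inv, hP, det_map_ofReal,
    Complex.norm_real, Real.norm_of_nonneg (det_imPart_pos Z).le, ← div_eq_inv_mul,
    one_le_div (det_imPart_pos Z)] at h1
  exact h1

/-- The base point `i` of the upper half space. -/
def basePoint (n : ℕ) : siegelUpperHalfSpace n :=
  ⟨Complex.I • 1, by simp [IsSymm], by
    have h : (Complex.I • (1 : Matrix (Fin n) (Fin n) ℂ)).map Complex.im = 1 := by
      ext i j
      by_cases h : i = j <;> simp [h, one_apply]
    rw [h]
    exact PosDef.one⟩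

/-- The determinant of `Ci + D` is a nonzero Gaussian integer, so its norm is a positive integer. -/
lemma one_le_norm_det_denomMatrix_basePoint (g : symplecticGroup (Fin n) ℤ) :
    1 ≤ ‖(denomMatrix (ofInt g) (basePoint n)).det‖ := by
  obtain ⟨M, hM⟩ : ∃ M : Matrix (Fin n) (Fin n) GaussianInt,
      denomMatrix (ofInt g) (basePoint n) = GaussianInt.toComplex.mapMatrix M := by
    refine ⟨of fun i j => ⟨g.1.toBlocks₂₂ i j, g.1.toBlocks₂₁ i j⟩, ?_⟩
    ext i j
    simp [denomMatrix, ofInt, spMap, basePoint, toBlocks₂₁, toBlocks₂₂, GaussianInt.toComplex_def']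
    ring
  have h0 := (norm_det_denomMatrix_pos (ofInt g) (basePoint n))
  rw [hM, ← RingHom.map_det] at h0 ⊢
  rw [norm_pos_iff, Ne, GaussianInt.toComplex_eq_zero, ← Ne, ← GaussianInt.norm_pos] at h0
  generalize M.det = x at *
  have h2 : (1 : ℝ) ≤ (x.norm : ℝ) := by exact_mod_cast h0
  rw [GaussianInt.intCast_real_norm, Complex.normSq_eq_norm_sq] at h2
  nlinarith [norm_nonneg (x : ℂ)]

lemma diag_nonneg_imPart (Z : siegelUpperHalfSpace n) (i : Fin n) : 0 ≤ imPart Z i i :=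
  (Z.2.2.diag_pos (i := i)).le

lemma trace_imPart_nonneg (Z : siegelUpperHalfSpace n) : 0 ≤ (imPart Z).trace :=
  Finset.sum_nonneg fun i _ => diag_nonneg_imPart Z i

/-- The entries of a positive semidefinite matrix are bounded by its trace. -/
lemma abs_apply_le_trace {Y : Matrix (Fin n) (Fin n) ℝ} (hY : Y.PosSemidef) (i j : Fin n) :
    |Y i j| ≤ Y.trace := by
  have hd : ∀ k, 0 ≤ Y k k := fun k => hY.diag_nonneg
  have hle : ∀ k, Y k k ≤ Y.trace := fun k =>
    Finset.single_le_sum (f := fun k => Y k k) (fun k _ => hd k) (Finset.mem_univ k)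
  have hs : Y j i = Y i j := by simpa using hY.1.apply i j
  have h1 := hY.dotProduct_mulVec_nonneg (Pi.single i 1 + Pi.single j 1)
  have h2 := hY.dotProduct_mulVec_nonneg (Pi.single i 1 - Pi.single j 1)
  simp [mulVec_add, mulVec_sub, hs] at h1 h2
  rw [abs_le]
  constructor <;> linarith [hle i, hle j]

lemma abs_re_le_half_exists_translation (Z : siegelUpperHalfSpace n) :
    ∃ (S : Matrix (Fin n) (Fin n) ℤ) (hS : S.IsSymm), ∀ i j,
      |((moebius (ofInt (translation S hS)) Z : Matrix (Fin n) (Fin n) ℂ) i j).re| ≤ 1 / 2 := by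
  obtain ⟨S, hS⟩ : ∃ S : Matrix (Fin n) (Fin n) ℤ, ∀ i j,
      S i j = -round ((Z : Matrix (Fin n) (Fin n) ℂ) i j).re := ⟨of fun i j => _, fun i j => rfl⟩
  have hSs : S.IsSymm := IsSymm.ext fun i j => by rw [hS, hS, Z.2.1.apply i j]
  refine ⟨S, hSs, fun i j => ?_⟩
  · rw [coe_moebius_translation]
    simpa [hS, ← sub_eq_add_neg] using abs_sub_round ((Z : Matrix (Fin n) (Fin n) ℂ) i j).re

/-- Leibniz expansion: each entry is at most `1 + 1/2 + Tr Y`. -/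
lemma norm_det_basePoint_sub_le (Z : siegelUpperHalfSpace n)
    (hZ : ∀ i j, |((Z : Matrix (Fin n) (Fin n) ℂ) i j).re| ≤ 1 / 2) :
    ‖((basePoint n : Matrix (Fin n) (Fin n) ℂ) - (Z : Matrix (Fin n) (Fin n) ℂ)ᴴ).det‖ ≤
      n.factorial * (2 * (1 + (imPart Z).trace)) ^ n := by
  have ht := trace_imPart_nonneg Z
  have h := det_le (abv := IsAbsoluteValue.toAbsoluteValue (norm : ℂ → ℝ))
    (A := (basePoint n : Matrix (Fin n) (Fin n) ℂ) - (Z : Matrix (Fin n) (Fin n) ℂ)ᴴ)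
    (x := 2 * (1 + (imPart Z).trace)) fun i j => by
      have h1 : |((Z : Matrix (Fin n) (Fin n) ℂ) j i).im| ≤ (imPart Z).trace :=
        abs_apply_le_trace Z.2.2.posSemidef j i
      have h2 : ‖(basePoint n : Matrix (Fin n) (Fin n) ℂ) i j‖ ≤ 1 := by
        by_cases hij : i = j <;> simp [basePoint, hij, one_apply]
      have h3 := Complex.norm_le_abs_re_add_abs_im ((Z : Matrix (Fin n) (Fin n) ℂ) j i)
      have h4 := norm_sub_le ((basePoint n : Matrix (Fin n) (Fin n) ℂ) i j)
        (star ((Z : Matrix (Fin n) (Fin n) ℂ) j i))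
      rw [norm_star] at h4
      have := hZ j i
      simp only [IsAbsoluteValue.toAbsoluteValue_apply, Matrix.sub_apply, conjTranspose_apply]
      linarith
  simpa using h

/-- Taking determinants in the polarized identity at `Z` and `i` bounds `|det J(g,Z)| · det(Im gZ)`
by `K`, because the other factor is at least `1`. Squaring and using `det(Im gZ) · |det J(g,Z)|² =
det Y` eliminates `J`. -/
lemma det_imPart_moebius_le (g : symplecticGroup (Fin n) ℤ) (Z : siegelUpperHalfSpace n) :
    (imPart (moebius (ofInt g) Z)).det ≤
      (n.factorial * (2 * (1 + (imPart Z).trace)) ^ n) ^ 2 / (imPart Z).det := by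
  -- An integral translation of `Z` preserves `Y` and can be absorbed into `g`.
  wlog hZ : ∀ i j, |((Z : Matrix (Fin n) (Fin n) ℂ) i j).re| ≤ 1 / 2 generalizing g Z
  · obtain ⟨S, hS, h⟩ := abs_re_le_half_exists_translation Z
    have := this (g * (translation S hS)⁻¹) _ h
    rwa [imPart_moebius_translation, ← moebius_mul, ← map_mul, inv_mul_cancel_right] at this
  have h1 := det_imPart_le_norm_det_sub (moebius (ofInt g) Z) (moebius (ofInt g) (basePoint n))
  have h2 := congrArg (fun M => ‖Matrix.det M‖) (denomMatrix_conj_sub (ofInt g) Z (basePoint n))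
  simp only [det_mul, det_conjTranspose, norm_mul, norm_star] at h2
  have h3 := norm_det_basePoint_sub_le Z hZ
  have h4 := det_imPart_moebius (ofInt g) Z
  have h5 := one_le_norm_det_denomMatrix_basePoint g
  have h6 := norm_det_denomMatrix_pos (ofInt g) Z
  have h7 := det_imPart_pos (moebius (ofInt g) Z)
  have h8 := det_imPart_pos Z
  rw [← h2] at h3
  generalize ‖(denomMatrix (ofInt g) Z).det‖ = a at *
  generalize ‖(denomMatrix (ofInt g) (basePoint n)).det‖ = b at *
  generalize (n.factorial * (2 * (1 + (imPart Z).trace)) ^ n : ℝ) = K at *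
  generalize ‖((moebius (ofInt g) (basePoint n) : Matrix (Fin n) (Fin n) ℂ) -
    (moebius (ofInt g) Z : Matrix (Fin n) (Fin n) ℂ)ᴴ).det‖ = w at *
  generalize (imPart (moebius (ofInt g) Z)).det = y' at *
  have h9 : a * y' ≤ K :=
    calc a * y' ≤ a * w * 1 := by rw [mul_one]; gcongr
      _ ≤ a * w * b := by gcongr; exact mul_nonneg h6.le (h7.le.trans h1)
      _ ≤ K := h3
  rw [le_div_iff₀ h8, ← h4]
  calc y' * (y' * a ^ 2) = (a * y') ^ 2 := by ring
    _ ≤ K ^ 2 := by gcongr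

end Height

section QuadraticForms

/-! ### Reduction of positive quadratic forms -/

/-- The value at `x` of the quadratic form with matrix `Y`. -/
def quadForm {ι : Type*} [Fintype ι] (Y : Matrix ι ι ℝ) (x : ι → ℝ) : ℝ := x ⬝ᵥ Y *ᵥ x

/-- An integral matrix as a real matrix. -/
abbrev intReal {ι : Type*} (U : Matrix ι ι ℤ) : Matrix ι ι ℝ := U.map (Int.cast : ℤ → ℝ)

lemma intReal_mul {ι : Type*} [Fintype ι] [DecidableEq ι] (U V : Matrix ι ι ℤ) :
    intReal (U * V) = intReal U * intReal V :=
  Matrix.map_mul (f := Int.castRingHom ℝ)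

lemma quadForm_conj {ι : Type*} [Fintype ι] (Y U : Matrix ι ι ℝ) (x : ι → ℝ) :
    quadForm (Uᵀ * Y * U) x = quadForm Y (U *ᵥ x) := by
  rw [quadForm, quadForm, ← mulVec_mulVec, ← mulVec_mulVec, dotProduct_mulVec, vecMul_transpose]

lemma quadForm_single {ι : Type*} [Fintype ι] [DecidableEq ι] (Y : Matrix ι ι ℝ) (i : ι) :
    quadForm Y (Pi.single i 1) = Y i i := by
  simp [quadForm]

lemma conj_apply_self {ι : Type*} [Fintype ι] [DecidableEq ι] (Y U : Matrix ι ι ℝ) (i : ι) :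
    (Uᵀ * Y * U) i i = quadForm (Uᵀ * Y * U) (Pi.single i 1) :=
  (quadForm_single _ i).symm

/-- Completing the square with respect to the first coordinate. -/
lemma quadForm_sum {ι : Type*} [Fintype ι] (Y : Matrix (Unit ⊕ ι) (Unit ⊕ ι) ℝ)
    (hY : Y.IsSymm) (ha : Y (.inl ()) (.inl ()) ≠ 0) (x : Unit ⊕ ι → ℝ) :
    quadForm Y x = Y (.inl ()) (.inl ()) * (x (.inl ()) +
        (fun i => Y (.inl ()) (.inr i) / Y (.inl ()) (.inl ())) ⬝ᵥ (fun i => x (.inr i))) ^ 2 +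
      quadForm (of fun i j => Y (.inr i) (.inr j) -
        Y (.inl ()) (.inr i) * Y (.inl ()) (.inr j) / Y (.inl ()) (.inl ()))
        (fun i => x (.inr i)) := by
  have hs : ∀ i, Y (.inr i) (.inl ()) = Y (.inl ()) (.inr i) := fun i => hY.apply _ _
  set a := Y (.inl ()) (.inl ())
  set s := ∑ i, Y (.inl ()) (.inr i) * x (.inr i) with hsdef
  set t := x (.inl ()) with ht
  have h1 : (fun i => Y (.inl ()) (.inr i) / a) ⬝ᵥ (fun i => x (.inr i)) = s / a := by
    simp only [dotProduct, hsdef, Finset.sum_div]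
    exact Finset.sum_congr rfl fun i _ => by ring
  have h2 : quadForm (of fun i j => Y (.inr i) (.inr j) -
        Y (.inl ()) (.inr i) * Y (.inl ()) (.inr j) / a) (fun i => x (.inr i)) =
      ∑ i, x (.inr i) * ∑ j, Y (.inr i) (.inr j) * x (.inr j) - s * s / a := by
    have : s * s / a = ∑ i, x (.inr i) *
        ∑ j, Y (.inl ()) (.inr i) * Y (.inl ()) (.inr j) / a * x (.inr j) := by
      rw [hsdef, Finset.sum_mul_sum, Finset.sum_div]
      refine Finset.sum_congr rfl fun i _ => ?_
      rw [Finset.mul_sum, Finset.sum_div]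
      exact Finset.sum_congr rfl fun j _ => by ring
    rw [this, ← Finset.sum_sub_distrib]
    simp only [quadForm, dotProduct, mulVec, of_apply, sub_mul, Finset.sum_sub_distrib, mul_sub]
  have h3 : quadForm Y x = t * (a * t + s) +
      ∑ i, x (.inr i) * (Y (.inl ()) (.inr i) * t +
        ∑ j, Y (.inr i) (.inr j) * x (.inr j)) := by
    simp [quadForm, dotProduct, mulVec, Fintype.sum_sum_type, hs, hsdef, a, t]
  have h4 : ∑ i, x (.inr i) * (Y (.inl ()) (.inr i) * t) = s * t := by
    rw [hsdef, Finset.sum_mul]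
    exact Finset.sum_congr rfl fun i _ => by ring
  rw [h1, h2, h3]
  simp only [mul_add, Finset.sum_add_distrib]
  rw [h4]
  field_simp
  ring

/-- The integral matrix `(1 t; 0 U)`. -/
def blockUnipotent {ι : Type*} (t : ι → ℤ) (U : Matrix ι ι ℤ) :
    Matrix (Unit ⊕ ι) (Unit ⊕ ι) ℤ :=
  fromBlocks 1 (replicateRow Unit t) 0 U

lemma isUnit_det_blockUnipotent {ι : Type*} [Fintype ι] [DecidableEq ι] (t : ι → ℤ)
    {U : Matrix ι ι ℤ} (hU : IsUnit U.det) : IsUnit (blockUnipotent t U).det := by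
  simpa [blockUnipotent, det_fromBlocks_zero₂₁] using hU

lemma blockUnipotent_mulVec_inl {ι : Type*} [Fintype ι] (t : ι → ℤ) (U : Matrix ι ι ℤ)
    (x : Unit ⊕ ι → ℝ) :
    (intReal (blockUnipotent t U) *ᵥ x) (.inl ()) =
      x (.inl ()) + (fun i => (t i : ℝ)) ⬝ᵥ (fun i => x (.inr i)) := by
  simp [blockUnipotent, mulVec, dotProduct, Fintype.sum_sum_type]

lemma blockUnipotent_mulVec_inr {ι : Type*} [Fintype ι] (t : ι → ℤ) (U : Matrix ι ι ℤ)
    (x : Unit ⊕ ι → ℝ) :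
    (fun i => (intReal (blockUnipotent t U) *ᵥ x) (.inr i)) =
      intReal U *ᵥ (fun i => x (.inr i)) := by
  ext i
  simp [blockUnipotent, mulVec, dotProduct, Fintype.sum_sum_type]

/-- Real vectors can be reduced modulo integral ones. -/
lemma exists_int_abs_add_le_half {ι : Type*} (β : ι → ℝ) :
    ∃ t : ι → ℤ, ∀ i, |(t i : ℝ) + β i| ≤ 1 / 2 :=
  ⟨fun i => -round (β i), fun i => by
    have := abs_sub_round (β i)
    push_cast
    rwa [neg_add_eq_sub]⟩

/-- Every integral lattice basis can be replaced by one that almost minimizes the first diagonal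
entry among all diagonal entries. -/
lemma exists_almost_minimal_diag {ι : Type*} [Fintype ι] [DecidableEq ι] (i₀ : ι) {m : ℝ}
    (hm : 0 < m) (Y : Matrix ι ι ℝ)
    (hY : ∀ (U : Matrix ι ι ℤ) (i : ι), IsUnit U.det → m ≤ ((intReal U)ᵀ * Y * intReal U) i i) :
    ∃ U₀ : Matrix ι ι ℤ, IsUnit U₀.det ∧ ∀ (U : Matrix ι ι ℤ) (i : ι), IsUnit U.det →
      3 / 4 * ((intReal U₀)ᵀ * Y * intReal U₀) i₀ i₀ ≤ ((intReal U)ᵀ * Y * intReal U) i i := by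
  set A : Set ℝ := {r | ∃ (U : Matrix ι ι ℤ) (i : ι), IsUnit U.det ∧
    ((intReal U)ᵀ * Y * intReal U) i i = r}
  have hne : A.Nonempty := ⟨_, 1, i₀, by simp, rfl⟩
  have hbd : BddBelow A := ⟨m, by rintro _ ⟨U, i, hU, rfl⟩; exact hY U i hU⟩
  have hinf : m ≤ sInf A := le_csInf hne (by rintro _ ⟨U, i, hU, rfl⟩; exact hY U i hU)
  -- The infimum is positive because of `m`, so some value lies below `4/3` of it; a column swap
  -- then moves the index `i` to `i₀`.
  obtain ⟨_, ⟨U, i, hU, rfl⟩, hlt⟩ := exists_lt_of_csInf_lt hne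
    (show sInf A < 4 / 3 * sInf A by linarith)
  refine ⟨U * (Equiv.swap i₀ i).permMatrix ℤ, ?_, fun U' i' hU' => ?_⟩
  · rw [det_mul, det_permutation]
    exact hU.mul (by simp)
  · have h1 : sInf A ≤ ((intReal U')ᵀ * Y * intReal U') i' i' := csInf_le hbd ⟨U', i', hU', rfl⟩
    have h2 : ((intReal (U * (Equiv.swap i₀ i).permMatrix ℤ))ᵀ * Y *
        intReal (U * (Equiv.swap i₀ i).permMatrix ℤ)) i₀ i₀ =
        ((intReal U)ᵀ * Y * intReal U) i i := by
      rw [conj_apply_self, conj_apply_self, quadForm_conj, quadForm_conj,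
        intReal_mul, ← mulVec_mulVec]
      congr 2
      ext k
      simp [PEquiv.toMatrix_apply, Equiv.Perm.permMatrix, Pi.single_apply, Equiv.swap_apply_eq_iff]
    rw [h2]
    linarith

/-- Quadratic forms in the variables `ι` all of whose integral bases consist of vectors of length
at least `m` are integrally equivalent to forms bounded below by a fixed multiple of `m` times the
standard form. -/
def HasReduction (ι : Type*) [Fintype ι] [DecidableEq ι] : Prop :=
  ∃ c : ℝ, 0 < c ∧ ∀ m : ℝ, 0 < m → ∀ Y : Matrix ι ι ℝ, Y.IsSymm →
    (∀ (U : Matrix ι ι ℤ) (i : ι), IsUnit U.det → m ≤ ((intReal U)ᵀ * Y * intReal U) i i) →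
    ∃ U : Matrix ι ι ℤ, IsUnit U.det ∧
      ∀ x, c * m * (x ⬝ᵥ x) ≤ quadForm ((intReal U)ᵀ * Y * intReal U) x

lemma HasReduction.of_equiv {ι κ : Type*} [Fintype ι] [DecidableEq ι] [Fintype κ] [DecidableEq κ]
    (e : ι ≃ κ) (h : HasReduction ι) : HasReduction κ := by
  have key : ∀ (U : Matrix ι ι ℤ) (Y : Matrix κ κ ℝ),
      (intReal (U.submatrix e.symm e.symm))ᵀ * Y * intReal (U.submatrix e.symm e.symm) =
        ((intReal U)ᵀ * Y.submatrix e e * intReal U).submatrix e.symm e.symm := by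
    intro U Y
    have : Y = (Y.submatrix e e).submatrix e.symm e.symm := by simp
    conv_lhs => rw [this]
    rw [← submatrix_mul_equiv _ _ _ e.symm, ← submatrix_mul_equiv _ _ _ e.symm]
    rfl
  obtain ⟨c, hc, h⟩ := h
  refine ⟨c, hc, fun m hm Y hY hU => ?_⟩
  obtain ⟨U, hU1, hU2⟩ := h m hm (Y.submatrix e e) (hY.submatrix e) fun U i hi => by
    have := hU (U.submatrix e.symm e.symm) (e i) (by rwa [det_submatrix_equiv_self])
    rw [key] at this
    simpa using this
  refine ⟨U.submatrix e.symm e.symm, by rwa [det_submatrix_equiv_self], fun x => ?_⟩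
  rw [key]
  have := hU2 (x ∘ e)
  rw [comp_equiv_dotProduct_comp_equiv] at this
  refine this.trans_eq ?_
  rw [quadForm, quadForm, submatrix_mulVec_equiv, dotProduct_comp_equiv_symm, Equiv.symm_symm]

lemma sq_dotProduct_le {ι : Type*} [Fintype ι] {τ : ι → ℝ} (hτ : ∀ i, |τ i| ≤ 1 / 2) (v : ι → ℝ) :
    (τ ⬝ᵥ v) ^ 2 ≤ Fintype.card ι / 4 * (v ⬝ᵥ v) := by
  have h := Finset.sum_mul_sq_le_sq_mul_sq Finset.univ τ v
  have h2 : ∑ i, τ i ^ 2 ≤ Fintype.card ι / 4 := by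
    calc ∑ i, τ i ^ 2 ≤ ∑ _i : ι, (1 / 4 : ℝ) := Finset.sum_le_sum fun i _ => by
          have := abs_le.1 (hτ i)
          nlinarith
      _ = Fintype.card ι / 4 := by simp; ring
  have h3 : v ⬝ᵥ v = ∑ i, v i ^ 2 := by simp [dotProduct, sq]
  rw [h3]
  exact h.trans (mul_le_mul_of_nonneg_right h2 (Finset.sum_nonneg fun i _ => sq_nonneg _))

/-- Hermite's induction. Make the first diagonal entry `a` almost minimal and complete the square.
The remaining form `Q` inherits the lower bound `a/2` on its diagonals, so it can be reduced by
induction; size-reducing the off-diagonal coefficients then controls the whole form. -/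
lemma HasReduction.unit_sum {ι : Type*} [Fintype ι] [DecidableEq ι] (h : HasReduction ι) :
    HasReduction (Unit ⊕ ι) := by
  obtain ⟨c, hc, h⟩ := h
  -- Chosen so that `K · (c/2) · v` contains `(card ι / 2 + 1) · v` while `K ≥ 2`, as needed for
  -- `h3` below.
  set K : ℝ := 2 + (Fintype.card ι / 2 + 1) * (2 / c) with hK
  have hKpos : 0 < K := by positivity
  refine ⟨1 / K, by positivity, fun m hm Y₀ hY₀ hYm => ?_⟩
  obtain ⟨U₀, hU₀, hmin⟩ := exists_almost_minimal_diag (.inl ()) hm Y₀ hYm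
  set Y := (intReal U₀)ᵀ * Y₀ * intReal U₀ with hYdef
  have hY : Y.IsSymm := by
    rw [IsSymm, hYdef, transpose_mul, transpose_mul, transpose_transpose, hY₀.eq, Matrix.mul_assoc]
  have hconj : ∀ U : Matrix (Unit ⊕ ι) (Unit ⊕ ι) ℤ,
      (intReal (U₀ * U))ᵀ * Y₀ * intReal (U₀ * U) = (intReal U)ᵀ * Y * intReal U := by
    intro U
    rw [intReal_mul, transpose_mul, hYdef]
    simp only [Matrix.mul_assoc]
  set a := Y (.inl ()) (.inl ()) with ha
  have ham : m ≤ a := hYm U₀ (.inl ()) hU₀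
  have hapos : 0 < a := hm.trans_le ham
  set β : ι → ℝ := fun i => Y (.inl ()) (.inr i) / a with hβ
  set Q : Matrix ι ι ℝ := of fun i j => Y (.inr i) (.inr j) -
        Y (.inl ()) (.inr i) * Y (.inl ()) (.inr j) / a with hQ
  have hQs : Q.IsSymm := IsSymm.ext fun i j => by
    simp only [hQ, of_apply]
    rw [hY.apply]
    ring
  -- Under the substitution `(1 t; 0 U)` the linear part `β` becomes `t + Uᵀβ` and the complement
  -- `Q` becomes `UᵀQU`. Hence `t` can be used to reduce `Uᵀβ` modulo integers without touching the
  -- second summand.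
  have hform : ∀ (t : ι → ℤ) (U : Matrix ι ι ℤ) (x : Unit ⊕ ι → ℝ),
      quadForm ((intReal (blockUnipotent t U))ᵀ * Y * intReal (blockUnipotent t U)) x =
      a * (x (.inl ()) + (fun i => (t i : ℝ) + ((intReal U)ᵀ *ᵥ β) i) ⬝ᵥ
        (fun i => x (.inr i))) ^ 2 +
        quadForm ((intReal U)ᵀ * Q * intReal U) (fun i => x (.inr i)) := by
    intro t U x
    rw [quadForm_conj, quadForm_sum Y hY hapos.ne', blockUnipotent_mulVec_inl,
      blockUnipotent_mulVec_inr, quadForm_conj Q, dotProduct_mulVec β, ← mulVec_transpose]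
    change _ = a * (x (.inl ()) + ((fun i => (t i : ℝ)) + ((intReal U)ᵀ *ᵥ β)) ⬝ᵥ
        (fun i => x (.inr i))) ^ 2 + _
    rw [add_dotProduct, ← add_assoc]
  -- With `t` size-reduced, the lifted basis vector has value at most `a/4` plus the diagonal entry
  -- of `UᵀQU`, and at least `3a/4` by near-minimality. This leaves `a/2` for `Q`.
  obtain ⟨U₁, hU₁, hred⟩ := h (a / 2) (by positivity) Q hQs fun U i hU => by
    obtain ⟨t, ht⟩ := exists_int_abs_add_le_half ((intReal U)ᵀ *ᵥ β)
    have h1 := hmin (U₀ * blockUnipotent t U) (.inr i)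
      (by rw [det_mul]; exact hU₀.mul (isUnit_det_blockUnipotent t hU))
    rw [hconj] at h1
    replace h1 := h1.trans_eq (conj_apply_self Y (intReal (blockUnipotent t U)) (.inr i))
    rw [hform] at h1
    have e1 : (fun j => (Pi.single (.inr i) 1 : Unit ⊕ ι → ℝ) (.inr j)) = Pi.single i 1 := by
      ext j
      simp [Pi.single_apply]
    rw [e1, quadForm_single, dotProduct_single] at h1
    simp only [ne_eq, reduceCtorEq, not_false_eq_true, Pi.single_eq_of_ne, zero_add, mul_one] at h1
    have h2 : ((t i : ℝ) + ((intReal U)ᵀ *ᵥ β) i) ^ 2 ≤ 1 / 4 := by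
      have := abs_le.1 (ht i)
      nlinarith
    have h3 := mul_le_mul_of_nonneg_left h2 hapos.le
    linarith
  obtain ⟨t, ht⟩ := exists_int_abs_add_le_half ((intReal U₁)ᵀ *ᵥ β)
  refine ⟨U₀ * blockUnipotent t U₁, by
    rw [det_mul]; exact hU₀.mul (isUnit_det_blockUnipotent t hU₁), fun x => ?_⟩
  rw [hconj, hform]
  have h1 := hred fun i => x (.inr i)
  have h2 := sq_dotProduct_le ht fun i => x (.inr i)
  have hx : x ⬝ᵥ x = x (.inl ()) ^ 2 + (fun i => x (.inr i)) ⬝ᵥ (fun i => x (.inr i)) := by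
    simp [dotProduct, sq]
  have hv : 0 ≤ (fun i => x (.inr i)) ⬝ᵥ (fun i => x (.inr i)) :=
    Finset.sum_nonneg fun i _ => mul_self_nonneg _
  rw [hx]
  generalize quadForm ((intReal U₁)ᵀ * Q * intReal U₁) _ = q at *
  generalize (fun i => (t i : ℝ) + ((intReal U₁)ᵀ *ᵥ β) i) ⬝ᵥ (fun i => x (.inr i)) = s at *
  generalize (fun i => x (.inr i)) ⬝ᵥ (fun i => x (.inr i)) = v at *
  generalize x (.inl ()) = y at *
  have h3 : y ^ 2 + v ≤ K * ((y + s) ^ 2 + c / 2 * v) := by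
    have e : K * ((y + s) ^ 2 + c / 2 * v) =
        2 * (y + s) ^ 2 + (Fintype.card ι / 2 + 1) * (2 / c) * (y + s) ^ 2 + c * v +
          (Fintype.card ι / 2 + 1) * v := by
      rw [hK]
      field_simp
      ring
    have h4 : 0 ≤ (Fintype.card ι / 2 + 1) * (2 / c) * (y + s) ^ 2 := by positivity
    have h5 : 0 ≤ c * v := by positivity
    rw [e]
    -- The hint is `y² ≤ 2(y + s)² + 2s²`; `h2` bounds `s²` by `card ι / 4 · v`.
    nlinarith [sq_nonneg (y + 2 * s)]
  have h6 : 0 ≤ (y + s) ^ 2 + c / 2 * v := by positivity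
  calc 1 / K * m * (y ^ 2 + v) ≤ 1 / K * m * (K * ((y + s) ^ 2 + c / 2 * v)) := by gcongr
    _ = m * ((y + s) ^ 2 + c / 2 * v) := by field_simp
    _ ≤ a * ((y + s) ^ 2 + c / 2 * v) := by gcongr
    _ = a * (y + s) ^ 2 + c * (a / 2) * v := by ring
    _ ≤ _ := by gcongr

theorem hasReduction_fin (n : ℕ) : HasReduction (Fin n) := by
  induction n with
  | zero => exact ⟨1, one_pos, fun m _ Y _ _ => ⟨1, by simp, fun x => by simp [quadForm]⟩⟩
  | succ n ih =>
    exact ih.unit_sum.of_equiv (Fintype.equivOfCardEq (by simp [add_comm]))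

end QuadraticForms

section Siegel

variable {n : ℕ}

/-! ### Siegel reduction -/

lemma ofInt_mul (g h : symplecticGroup (Fin n) ℤ) : ofInt (g * h) = ofInt g * ofInt h :=
  map_mul _ g h

lemma isSymm_imPart (Z : siegelUpperHalfSpace n) : (imPart Z).IsSymm := by
  rw [IsSymm, imPart, ← transpose_map, Z.2.1.eq]

lemma det_imPart_moebius_levi (U : Matrix (Fin n) (Fin n) ℤ) (hU : IsUnit U.det)
    (Z : siegelUpperHalfSpace n) :
    (imPart (moebius (ofInt (levi U hU)) Z)).det = (imPart Z).det := by
  have h : (U.map (Int.cast : ℤ → ℝ)).det = (U.det : ℝ) :=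
    (RingHom.map_det (Int.castRingHom ℝ) U).symm
  have h2 : (U.det : ℝ) * U.det = 1 := by
    rcases Int.isUnit_iff.1 hU with h | h <;> simp [h]
  rw [imPart_moebius_levi, det_mul, det_mul, det_transpose, h]
  linear_combination (imPart Z).det * h2

/-- A point whose height is almost maximal in its orbit under `Sp_{2n}(ℤ)`. -/
lemma exists_almost_maximal_height (Z : siegelUpperHalfSpace n) :
    ∃ g : symplecticGroup (Fin n) ℤ, ∀ h : symplecticGroup (Fin n) ℤ,
      9 / 10 * (imPart (moebius (ofInt h) (moebius (ofInt g) Z))).det ≤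
        (imPart (moebius (ofInt g) Z)).det := by
  set A : Set ℝ := Set.range fun g : symplecticGroup (Fin n) ℤ =>
    (imPart (moebius (ofInt g) Z)).det with hA
  have hbd : BddAbove A := ⟨_, by rintro _ ⟨g, rfl⟩; exact det_imPart_moebius_le g Z⟩
  have hmem : ∀ g, (imPart (moebius (ofInt g) Z)).det ∈ A := fun g => ⟨g, rfl⟩
  have hpos : 0 < sSup A := (det_imPart_pos _).trans_le (le_csSup hbd (hmem 1))
  obtain ⟨_, ⟨g, rfl⟩, hg⟩ := exists_lt_of_lt_csSup ⟨_, hmem 1⟩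
    (show 9 / 10 * sSup A < sSup A by linarith)
  refine ⟨g, fun h => ?_⟩
  have := le_csSup hbd (hmem (h * g))
  rw [ofInt_mul, moebius_mul] at this
  linarith

/-- Move `Z` by `U` and a translation to `W` with `|Re W i i| ≤ 1/2` and the same height. Inverting
coordinate `i` divides the height by `|W i i|²`, so almost maximality gives `|W i i|² ≥ 9/10`. -/
lemma half_le_diag_of_almost_maximal_height (Z : siegelUpperHalfSpace n)
    (hZ : ∀ h : symplecticGroup (Fin n) ℤ,
      9 / 10 * (imPart (moebius (ofInt h) Z)).det ≤ (imPart Z).det)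
    (U : Matrix (Fin n) (Fin n) ℤ) (i : Fin n) (hU : IsUnit U.det) :
    1 / 2 ≤ ((intReal U)ᵀ * imPart Z * intReal U) i i := by
  obtain ⟨S, hS, hre⟩ := abs_re_le_half_exists_translation (moebius (ofInt (levi U hU)) Z)
  set W := moebius (ofInt (translation S hS)) (moebius (ofInt (levi U hU)) Z) with hW
  have hY : imPart W = (intReal U)ᵀ * imPart Z * intReal U := by
    rw [hW, imPart_moebius_translation, imPart_moebius_levi]
  have hdet : (imPart W).det = (imPart Z).det := by
    rw [hW, imPart_moebius_translation, det_imPart_moebius_levi]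
  have h1 := hZ (partialInversion i * (translation S hS * levi U hU))
  rw [ofInt_mul, ofInt_mul, moebius_mul, moebius_mul, ← hW, ← hdet,
    ← det_imPart_moebius (ofInt (partialInversion i)) W, det_denomMatrix_partialInversion,
    mul_comm] at h1
  have h2 := le_of_mul_le_mul_left h1 (det_imPart_pos _)
  have h3 := abs_le.1 (hre i i)
  have h4 : 0 ≤ ((W : Matrix (Fin n) (Fin n) ℂ) i i).im := diag_nonneg_imPart W i
  rw [← hY]
  change 1 / 2 ≤ ((W : Matrix (Fin n) (Fin n) ℂ) i i).im
  rw [← Complex.normSq_eq_norm_sq, Complex.normSq_apply] at h2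
  -- The imaginary part has square at least `9/10 - 1/4`, which exceeds `1/4`.
  nlinarith

/-- Every point of the upper half space is equivalent under `Sp_{2n}(ℤ)` to one whose imaginary
part is bounded below. -/
theorem exists_moebius_imPart_ge (n : ℕ) :
    ∃ c : ℝ, 0 < c ∧ ∀ Z : siegelUpperHalfSpace n, ∃ g : symplecticGroup (Fin n) ℤ,
      ∀ x, c * (x ⬝ᵥ x) ≤ quadForm (imPart (moebius (ofInt g) Z)) x := by
  obtain ⟨c, hc, h⟩ := hasReduction_fin n
  refine ⟨c * (1 / 2), by positivity, fun Z => ?_⟩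
  obtain ⟨g, hg⟩ := exists_almost_maximal_height Z
  obtain ⟨U, hU, hred⟩ := h (1 / 2) (by norm_num) (imPart (moebius (ofInt g) Z))
    (isSymm_imPart _)
    (half_le_diag_of_almost_maximal_height _ hg)
  refine ⟨levi U hU * g, ?_⟩
  rw [ofInt_mul, moebius_mul, imPart_moebius_levi]
  exact hred

/-! ### Consequences of a lower bound for the imaginary part -/

lemma posSemidef_sub_of_le_quadForm {Y : Matrix (Fin n) (Fin n) ℝ} (hY : Y.PosDef) {c : ℝ}
    (h : ∀ x, c * (x ⬝ᵥ x) ≤ quadForm Y x) : (Y - c • 1).PosSemidef := by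
  refine PosSemidef.of_dotProduct_mulVec_nonneg (hY.1.sub (by simp [IsHermitian])) fun x => ?_
  have := h x
  simp only [quadForm] at this
  simp [sub_mulVec, smul_mulVec, this]

/-- Evaluate the hypothesis at `Y⁻¹x` and combine it with `|x - cY⁻¹x|² ≥ 0`; no diagonalization is
needed. -/
lemma posSemidef_inv_of_le_quadForm {Y : Matrix (Fin n) (Fin n) ℝ} (hY : Y.PosDef) {c : ℝ}
    (hc : 0 < c) (h : ∀ x, c * (x ⬝ᵥ x) ≤ quadForm Y x) :
    (c⁻¹ • (1 : Matrix (Fin n) (Fin n) ℝ) - Y⁻¹).PosSemidef := by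
  have hu : IsUnit Y.det := (isUnit_iff_isUnit_det _).1 hY.isUnit
  refine PosSemidef.of_dotProduct_mulVec_nonneg ((by simp [IsHermitian] : IsHermitian _).sub
    hY.1.inv) fun x => ?_
  have h1 := h (Y⁻¹ *ᵥ x)
  rw [quadForm, mulVec_mulVec, mul_nonsing_inv _ hu, one_mulVec] at h1
  have h2 : 0 ≤ (x - c • Y⁻¹ *ᵥ x) ⬝ᵥ (x - c • Y⁻¹ *ᵥ x) :=
    Finset.sum_nonneg fun i _ => mul_self_nonneg _
  simp only [sub_dotProduct, dotProduct_sub, smul_dotProduct, dotProduct_smul, smul_eq_mul] at h2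
  rw [dotProduct_comm x (Y⁻¹ *ᵥ x)] at h2
  simp only [star_trivial, sub_mulVec, smul_mulVec, one_mulVec, dotProduct_sub, dotProduct_smul,
    smul_eq_mul]
  rw [dotProduct_comm x (Y⁻¹ *ᵥ x)]
  generalize (Y⁻¹ *ᵥ x) ⬝ᵥ (Y⁻¹ *ᵥ x) = p at *
  generalize (Y⁻¹ *ᵥ x) ⬝ᵥ x = q at *
  generalize x ⬝ᵥ x = r at *
  have h3 : q ≤ c⁻¹ * r := by
    rw [inv_mul_eq_div, le_div_iff₀ hc]
    nlinarith [mul_le_mul_of_nonneg_left h1 hc.le]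
  linarith

lemma trace_inv_le_of_le_quadForm {Y : Matrix (Fin n) (Fin n) ℝ} (hY : Y.PosDef) {c : ℝ}
    (hc : 0 < c) (h : ∀ x, c * (x ⬝ᵥ x) ≤ quadForm Y x) : Y⁻¹.trace ≤ n * c⁻¹ := by
  have := (posSemidef_inv_of_le_quadForm hY hc h).trace_nonneg
  simp only [trace_sub, trace_smul, trace_one, Fintype.card_fin, smul_eq_mul] at this
  linarith

end Siegel

section Growth

variable {n : ℕ}

/-! ### Growth of representations -/

open scoped ComplexOrder in
/-- The QR decomposition, in the form `h β = k` with `β` upper triangular and `k` unitary. -/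
lemma exists_mul_triangular_eq_unitary (h : GL (Fin n) ℂ) :
    ∃ β : GL (Fin n) ℂ, (β : Matrix (Fin n) (Fin n) ℂ).BlockTriangular id ∧
      ((h * β : GL (Fin n) ℂ) : Matrix (Fin n) (Fin n) ℂ) ∈ unitaryGroup (Fin n) ℂ := by
  have hS : ((h : Matrix (Fin n) (Fin n) ℂ)ᴴ * (h : Matrix (Fin n) (Fin n) ℂ)).PosDef :=
    PosDef.conjTranspose_mul_self _ (mulVec_injective_iff_isUnit.2 h.isUnit)
  -- Here `M(h^*h)M^*` is diagonal and positive with `M` lower triangular. Thus `β = M^*E`, with `E`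
  -- the inverse square root of that diagonal matrix, is upper triangular and makes `hβ` unitary.
  set M := LDL.lowerInv hS with hM
  have hMu : IsUnit M := isUnit_of_invertible M
  have hdiag : diagonal (LDL.diagEntries hS) =
      M * ((h : Matrix (Fin n) (Fin n) ℂ)ᴴ * (h : Matrix (Fin n) (Fin n) ℂ)) * Mᴴ :=
    LDL.diag_eq_lowerInv_conj hS
  have hpos : ∀ i, 0 < LDL.diagEntries hS i := by
    have : (diagonal (LDL.diagEntries hS)).PosDef := by
      rw [hdiag]
      exact hS.mul_mul_conjTranspose_same (vecMul_injective_iff_isUnit.2 hMu)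
    exact posDef_diagonal_iff.1 this
  obtain ⟨r, hr, hr0⟩ : ∃ r : Fin n → ℝ, (∀ i, LDL.diagEntries hS i = r i) ∧ ∀ i, 0 < r i := by
    refine ⟨fun i => (LDL.diagEntries hS i).re, fun i => ?_, fun i => (Complex.lt_def.1 (hpos i)).1⟩
    apply Complex.ext <;> simp [← (Complex.lt_def.1 (hpos i)).2]
  set E : Matrix (Fin n) (Fin n) ℂ := diagonal fun i => (((√(r i))⁻¹ : ℝ) : ℂ) with hE
  have hEu : IsUnit E := by
    rw [hE, isUnit_diagonal, Pi.isUnit_iff]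
    intro i
    have := (Real.sqrt_pos.2 (hr0 i)).ne'
    simp [this]
  have hEH : Eᴴ = E := by
    rw [hE, diagonal_conjTranspose]
    congr 1
    ext i
    simp
  have hMHu : IsUnit Mᴴ := by rw [← star_eq_conjTranspose]; exact hMu.star
  refine ⟨(hMHu.mul hEu).unit, ?_, ?_⟩
  · rw [IsUnit.unit_spec]
    refine BlockTriangular.mul ?_ (blockTriangular_diagonal _)
    intro i j hij
    have hji : M j i = 0 := LDL.lowerInv_triangular hS hij
    rw [conjTranspose_apply, hji, star_zero]
  · rw [mem_unitaryGroup_iff', star_eq_conjTranspose, Units.val_mul, IsUnit.unit_spec,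
      conjTranspose_mul, conjTranspose_mul, conjTranspose_conjTranspose, hEH]
    calc E * M * (h : Matrix (Fin n) (Fin n) ℂ)ᴴ * ((h : Matrix (Fin n) (Fin n) ℂ) * (Mᴴ * E))
        = E * (M * ((h : Matrix (Fin n) (Fin n) ℂ)ᴴ * (h : Matrix (Fin n) (Fin n) ℂ)) * Mᴴ) * E := by
          simp only [Matrix.mul_assoc]
      _ = 1 := by
          rw [← hdiag, hE, diagonal_mul_diagonal, diagonal_mul_diagonal, ← diagonal_one]
          congr 1
          ext i
          rw [hr i]
          have h1 : (√(r i))⁻¹ * r i * (√(r i))⁻¹ = 1 := by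
            have h2 := Real.mul_self_sqrt (hr0 i).le
            have h3 := (Real.sqrt_pos.2 (hr0 i)).ne'
            field_simp
            rw [sq, h2]
          exact_mod_cast h1

lemma exists_norm_apply_le (A : Matrix (Fin n) (Fin n) ℂ) : ∃ a : ℝ, ∀ i j, ‖A i j‖ ≤ a := by
  obtain ⟨a, ha⟩ := (Set.finite_range fun ij : Fin n × Fin n => ‖A ij.1 ij.2‖).bddAbove
  exact ⟨a, fun i j => ha ⟨(i, j), rfl⟩⟩

lemma norm_mul_apply_le {A B : Matrix (Fin n) (Fin n) ℂ} {a b : ℝ} (hA : ∀ i j, ‖A i j‖ ≤ a)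
    (hB : ∀ i j, ‖B i j‖ ≤ b) (i j : Fin n) : ‖(A * B) i j‖ ≤ n * (a * b) := by
  rw [mul_apply]
  refine (norm_sum_le _ _).trans ?_
  calc ∑ k, ‖A i k * B k j‖ ≤ ∑ _k : Fin n, a * b := Finset.sum_le_sum fun k _ => by
        rw [norm_mul]
        exact mul_le_mul (hA _ _) (hB _ _) (norm_nonneg _) ((norm_nonneg _).trans (hA i k))
    _ = n * (a * b) := by simp

variable {V : Type*} [NormedAddCommGroup V] [InnerProductSpace ℂ V]

/-- The vectors `w` such that `ρ(s) w` is bounded by a multiple of `|det s|^ℓ` as long as `s⁻¹`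
remains bounded. -/
def HasDetGrowth (ρ : Representation ℂ (GL (Fin n) ℂ) V) (l : ℕ) (w : V) : Prop :=
  ∀ M : ℝ, ∃ C : ℝ, ∀ s : GL (Fin n) ℂ,
    (∀ i j, ‖((s⁻¹ : GL (Fin n) ℂ) : Matrix (Fin n) (Fin n) ℂ) i j‖ ≤ M) →
      ‖ρ s w‖ ≤ C * ‖(s : Matrix (Fin n) (Fin n) ℂ).det‖ ^ l

/-- The subrepresentation of vectors of bounded determinantal growth. -/
def detGrowthSubrepresentation (ρ : Representation ℂ (GL (Fin n) ℂ) V) (l : ℕ) :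
    Subrepresentation ρ where
  toSubmodule :=
    { carrier := {w | HasDetGrowth ρ l w}
      zero_mem' := fun M => ⟨0, fun s _ => by simp⟩
      add_mem' := fun {a b} ha hb M => by
        obtain ⟨C, hC⟩ := ha M
        obtain ⟨D, hD⟩ := hb M
        refine ⟨C + D, fun s hs => ?_⟩
        rw [map_add, add_mul]
        exact (norm_add_le _ _).trans (add_le_add (hC s hs) (hD s hs))
      smul_mem' := fun z w hw M => by
        obtain ⟨C, hC⟩ := hw M
        refine ⟨‖z‖ * C, fun s hs => ?_⟩
        rw [map_smul, norm_smul, mul_assoc]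
        exact mul_le_mul_of_nonneg_left (hC s hs) (norm_nonneg _) }
  apply_mem_toSubmodule g w hw := fun M => by
    obtain ⟨G, hG⟩ := exists_norm_apply_le ((g⁻¹ : GL (Fin n) ℂ) : Matrix (Fin n) (Fin n) ℂ)
    obtain ⟨C, hC⟩ := hw (n * (G * M))
    refine ⟨C * ‖(g : Matrix (Fin n) (Fin n) ℂ).det‖ ^ l, fun s hs => ?_⟩
    -- Since `ρ(s)ρ(g)w = ρ(sg)w`, translation by `g` only changes the bound on the inverse and
    -- contributes the constant `|det g|^l`.
    have := hC (s * g) fun i j => by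
      rw [_root_.mul_inv_rev, Units.val_mul]
      exact norm_mul_apply_le hG hs i j
    rw [map_mul, Units.val_mul, det_mul, norm_mul, mul_pow] at this
    refine this.trans_eq ?_
    ring

/-- Write `sβ = k` with `β` triangular and `k` unitary. Then `‖v‖ = |χ(β)| ‖ρ(s)v‖` and `|det s| ∏
|β_ii| = 1`. If all weights equalled `l`, this would be an equality `‖ρ(s)v‖ = |det s|^l ‖v‖`; the
missing exponents `l - lam i` cost only powers of the bound `K` for `|β_ii|`. -/
lemma hasDetGrowth_of_highestWeight (ρ : Representation ℂ (GL (Fin n) ℂ) V)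
    (hρ : ∀ k : GL (Fin n) ℂ, (k : Matrix (Fin n) (Fin n) ℂ) ∈ unitaryGroup (Fin n) ℂ →
      ∀ w : V, ‖ρ k w‖ = ‖w‖)
    {lam : Fin n → ℕ} {l : ℕ} (hl : ∀ i, lam i ≤ l) {v : V}
    (hv : ∀ b : GL (Fin n) ℂ, (b : Matrix (Fin n) (Fin n) ℂ).BlockTriangular id →
      ρ b v = (∏ i, (b : Matrix (Fin n) (Fin n) ℂ) i i ^ lam i) • v) :
    HasDetGrowth ρ l v := by
  intro M
  set K : ℝ := max 1 (n * (M * 1)) with hK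
  refine ⟨K ^ (∑ i, (l - lam i)) * ‖v‖, fun s hs => ?_⟩
  obtain ⟨β, hβ, hk⟩ := exists_mul_triangular_eq_unitary s
  have hβK : ∀ i, ‖(β : Matrix (Fin n) (Fin n) ℂ) i i‖ ≤ K := fun i => by
    -- Entries of `s⁻¹` are bounded by `M` and those of the unitary factor by `1`.
    have e : β = s⁻¹ * (s * β) := by group
    rw [e, Units.val_mul]
    exact (norm_mul_apply_le hs (fun i j => entry_norm_bound_of_unitary hk i j) i i).trans
      (le_max_right _ _)
  set χ := ∏ i, (β : Matrix (Fin n) (Fin n) ℂ) i i ^ lam i with hχ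
  have h1 : ‖χ‖ * ‖ρ s v‖ = ‖v‖ := by
    rw [← norm_smul, ← map_smul, ← hv β hβ, ← Module.End.mul_apply, ← map_mul, hρ _ hk]
  have h2 : ‖(s : Matrix (Fin n) (Fin n) ℂ).det‖ *
      ∏ i, ‖(β : Matrix (Fin n) (Fin n) ℂ) i i‖ = 1 := by
    rw [← norm_prod, ← det_of_isUpperTriangular hβ, ← norm_mul, ← det_mul, ← Units.val_mul]
    exact CStarRing.norm_of_mem_unitary (det_of_mem_unitary hk)
  have h3 : (∏ i, ‖(β : Matrix (Fin n) (Fin n) ℂ) i i‖) ^ l ≤ ‖χ‖ * K ^ (∑ i, (l - lam i)) := by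
    rw [← Finset.prod_pow, hχ, norm_prod, ← Finset.prod_pow_eq_pow_sum, ← Finset.prod_mul_distrib]
    refine Finset.prod_le_prod (fun i _ => by positivity) fun i _ => ?_
    rw [norm_pow, ← Nat.add_sub_cancel' (hl i), pow_add, Nat.add_sub_cancel' (hl i)]
    have := hβK i
    gcongr
  have h4 : 1 ≤ ‖(s : Matrix (Fin n) (Fin n) ℂ).det‖ ^ l * (‖χ‖ * K ^ (∑ i, (l - lam i))) := by
    calc (1 : ℝ) = (‖(s : Matrix (Fin n) (Fin n) ℂ).det‖ *
          ∏ i, ‖(β : Matrix (Fin n) (Fin n) ℂ) i i‖) ^ l := by rw [h2, one_pow]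
      _ ≤ _ := by rw [mul_pow]; gcongr
  calc ‖ρ s v‖ = ‖ρ s v‖ * 1 := (mul_one _).symm
    _ ≤ ‖ρ s v‖ * (‖(s : Matrix (Fin n) (Fin n) ℂ).det‖ ^ l *
          (‖χ‖ * K ^ (∑ i, (l - lam i)))) := by gcongr
    _ = K ^ (∑ i, (l - lam i)) * (‖χ‖ * ‖ρ s v‖) *
          ‖(s : Matrix (Fin n) (Fin n) ℂ).det‖ ^ l := by ring
    _ = _ := by rw [h1]

/-- In an irreducible unitarizable representation of highest weight `lam`, every vector has
determinantal growth of order `max lam`. -/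
theorem hasDetGrowth_of_irreducible (ρ : Representation ℂ (GL (Fin n) ℂ) V)
    (hirr : ρ.IsIrreducible)
    (hρ : ∀ k : GL (Fin n) ℂ, (k : Matrix (Fin n) (Fin n) ℂ) ∈ unitaryGroup (Fin n) ℂ →
      ∀ w : V, ‖ρ k w‖ = ‖w‖)
    {lam : Fin n → ℕ} {l : ℕ} (hl : ∀ i, lam i ≤ l) (hlam : IsHighestWeight ρ lam) (w : V) :
    HasDetGrowth ρ l w := by
  obtain ⟨v, hv0, hv⟩ := hlam
  have hmem : v ∈ (detGrowthSubrepresentation ρ l).toSubmodule :=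
    hasDetGrowth_of_highestWeight ρ hρ hl hv
  have htop : detGrowthSubrepresentation ρ l = ⊤ := by
    refine (hirr.eq_bot_or_eq_top _).resolve_left fun hbot => hv0 ?_
    rw [hbot] at hmem
    exact (Submodule.mem_bot ℂ).1 hmem
  have hw : w ∈ (detGrowthSubrepresentation ρ l).toSubmodule := by
    rw [htop]
    exact Submodule.mem_top
  exact hw

/-! ### Boundedness of Fourier expansions -/

/-- The absolute value depends on `Z` only through `Y`, which allows terms at different points to be
compared. -/
lemma norm_fourierTerm (a : ℂ) (b : UpperIndex n → ℕ) (S : Matrix (Fin n) (Fin n) ℝ)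
    (Z : siegelUpperHalfSpace n) :
    ‖fourierTerm a b S Z‖ = ‖a‖ * Real.exp (-(2 * Real.pi * (S * imPart Z).trace)) *
      ∏ ij, |(imPart Z)⁻¹ ij.1.1 ij.1.2| ^ b ij := by
  rw [fourierTerm, norm_mul, norm_mul, Complex.norm_exp, Complex.norm_real, matrixMonomial,
    norm_prod]
  congr 2
  · congr 1
    have : (S.map Complex.ofReal * (Z : Matrix (Fin n) (Fin n) ℂ)).trace.im =
        (S * imPart Z).trace := by
      simp [trace, Matrix.mul_apply, imPart]
    rw [← this]
    simp
  · ext i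
    simp

open scoped MatrixOrder in
lemma trace_mul_nonneg {A B : Matrix (Fin n) (Fin n) ℝ} (hA : A.PosSemidef) (hB : B.PosSemidef) :
    0 ≤ (A * B).trace := by
  obtain ⟨C, rfl⟩ := CStarAlgebra.nonneg_iff_eq_star_mul_self.1 hB.nonneg
  rw [star_eq_conjTranspose]
  rw [← Matrix.mul_assoc, trace_mul_comm, ← Matrix.mul_assoc]
  exact (hA.mul_mul_conjTranspose_same C).trace_nonneg

/-- The point `i (t (1 + J))⁻¹`, where `J` is the matrix with all entries equal to `1`: its
imaginary part is small, and the inverse of its imaginary part has large entries. -/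
lemma exists_point_small_imPart (n : ℕ) {c : ℝ} (hc : 0 < c) :
    ∃ Z : siegelUpperHalfSpace n, (c • (1 : Matrix (Fin n) (Fin n) ℝ) - imPart Z).PosSemidef ∧
      ∀ i j, n * c⁻¹ ≤ (imPart Z)⁻¹ i j := by
  -- The matrix `R = t(1 + J)` satisfies `R ≥ t`, so `R⁻¹ ≤ t⁻¹ ≤ c`. All its entries, also off the
  -- diagonal thanks to `J`, are at least `t ≥ n/c`.
  set t : ℝ := (n + 1) * c⁻¹ with ht
  have htpos : 0 < t := by positivity
  set R : Matrix (Fin n) (Fin n) ℝ := t • (1 + of fun _ _ => 1) with hR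
  have hJ : (of fun _ _ => 1 : Matrix (Fin n) (Fin n) ℝ).PosSemidef := by
    have : (of fun _ _ => 1 : Matrix (Fin n) (Fin n) ℝ) =
        vecMulVec (fun _ => 1) (star fun _ => 1) := by
      ext i j
      simp [vecMulVec_apply]
    rw [this]
    exact posSemidef_vecMulVec_self_star _
  have hRpos : R.PosDef := (PosDef.one.add_posSemidef hJ).smul htpos
  have hRu : IsUnit R.det := (isUnit_iff_isUnit_det _).1 hRpos.isUnit
  have him : ((R⁻¹.map Complex.ofReal).map (Complex.I * ·)).map Complex.im = R⁻¹ := by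
    ext i j
    simp
  have hRs : (R⁻¹).IsSymm := by simpa using hRpos.1.inv
  refine ⟨⟨(R⁻¹.map Complex.ofReal).map (Complex.I * ·), ?_, ?_⟩, ?_⟩
  · exact IsSymm.ext fun i j => by simp [hRs.apply i j]
  · rw [him]
    exact hRpos.inv
  · have e : imPart ⟨(R⁻¹.map Complex.ofReal).map (Complex.I * ·),
        IsSymm.ext fun i j => by simp [hRs.apply i j], by rw [him]; exact hRpos.inv⟩ = R⁻¹ := him
    rw [e, nonsing_inv_nonsing_inv _ hRu]
    constructor
    · have h := posSemidef_inv_of_le_quadForm hRpos htpos fun x => by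
        have := hJ.dotProduct_mulVec_nonneg x
        simp only [star_trivial] at this
        rw [hR, quadForm, smul_mulVec, add_mulVec, one_mulVec, dotProduct_smul, dotProduct_add,
          smul_eq_mul]
        nlinarith
      have h2 : t⁻¹ ≤ c := by
        rw [ht, mul_inv, inv_inv]
        exact mul_le_of_le_one_left hc.le (inv_le_one_of_one_le₀ (by linarith [n.cast_nonneg (α := ℝ)]))
      have h3 : c • (1 : Matrix (Fin n) (Fin n) ℝ) - R⁻¹ =
          (c - t⁻¹) • (1 : Matrix (Fin n) (Fin n) ℝ) + (t⁻¹ • 1 - R⁻¹) := by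
        rw [sub_smul]
        abel
      rw [h3]
      exact (PosSemidef.one.smul (sub_nonneg.2 h2)).add h
    · intro i j
      have h1 : n * c⁻¹ ≤ t := by
        rw [ht]
        gcongr
        linarith
      have h2 : (0 : ℝ) ≤ (1 : Matrix (Fin n) (Fin n) ℝ) i j := by
        by_cases h : i = j <;> simp [one_apply, h]
      simp only [hR, Matrix.smul_apply, Matrix.add_apply, of_apply, smul_eq_mul]
      nlinarith

/-- A function with a nice Fourier expansion is bounded where `Y` is bounded below. -/
theorem HasNiceFourierExpansion.bounded {p : ℕ} {f : siegelUpperHalfSpace n → ℂ}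
    (hf : HasNiceFourierExpansion p f) {c : ℝ} (hc : 0 < c) :
    ∃ B : ℝ, ∀ Z, (∀ x, c * (x ⬝ᵥ x) ≤ quadForm (imPart Z) x) → ‖f Z‖ ≤ B := by
  obtain ⟨N, -, a, hsum, hunif⟩ := hf
  obtain ⟨W, hW1, hW2⟩ := exists_point_small_imPart n hc
  -- The bound is the absolute sum at `W`. As `Im W ≤ c ≤ Y` and `S ≥ 0`, the exponentials at `Z`
  -- are smaller; the entries of `Y⁻¹` are at most `Tr Y⁻¹ ≤ n/c`, hence at most those of `(Im
  -- W)⁻¹`.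
  refine ⟨∑' bS : boundedExponents n p × fourierIndex n N,
    ‖fourierTerm (a bS.1 bS.2) bS.1 bS.2 W‖, fun Z hZ => ?_⟩
  have hfs := (hunif {Z} isCompact_singleton).hasSum (Set.mem_singleton Z)
  rw [← hfs.tsum_eq]
  refine (norm_tsum_le_tsum_norm (hsum Z)).trans ((hsum Z).tsum_le_tsum (fun bS => ?_) (hsum W))
  rw [norm_fourierTerm, norm_fourierTerm]
  have hS : (bS.2 : Matrix (Fin n) (Fin n) ℝ).PosSemidef := bS.2.2.1
  have h1 : ((bS.2 : Matrix (Fin n) (Fin n) ℝ) * imPart W).trace ≤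
      ((bS.2 : Matrix (Fin n) (Fin n) ℝ) * imPart Z).trace := by
    have h := trace_mul_nonneg hS (hW1.add (posSemidef_sub_of_le_quadForm Z.2.2 hZ))
    have e : c • (1 : Matrix (Fin n) (Fin n) ℝ) - imPart W +
        ((Z : Matrix (Fin n) (Fin n) ℂ).map Complex.im - c • 1) = imPart Z - imPart W := by
      rw [imPart, imPart]
      abel
    rw [e, Matrix.mul_sub, trace_sub] at h
    linarith
  have h2 : ∀ i j, |(imPart Z)⁻¹ i j| ≤ |(imPart W)⁻¹ i j| := fun i j =>
    (abs_apply_le_trace Z.2.2.inv.posSemidef i j).trans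
      ((trace_inv_le_of_le_quadForm Z.2.2 hc hZ).trans ((hW2 i j).trans (le_abs_self _)))
  have := Real.pi_pos
  refine mul_le_mul (by gcongr) (Finset.prod_le_prod (fun _ _ => by positivity) fun ij _ =>
    pow_le_pow_left₀ (abs_nonneg _) (h2 _ _) _) (by positivity) (by positivity)

end Growth

section Forms

variable {n : ℕ}

/-! ### The square root of the imaginary part -/

open scoped MatrixOrder in
lemma sqrtImPart_mul_self (Z : siegelUpperHalfSpace n) :
    (sqrtImPart Z : Matrix (Fin n) (Fin n) ℂ) * (sqrtImPart Z : Matrix (Fin n) (Fin n) ℂ) =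
      (imPart Z).map Complex.ofReal := by
  rw [sqrtImPart, IsUnit.unit_spec, ← map_ofReal_mul,
    CFC.sqrt_mul_sqrt_self _ (PosDef.posSemidef (M := imPart Z) Z.2.2).nonneg]

open scoped MatrixOrder in
lemma conjTranspose_sqrtImPart (Z : siegelUpperHalfSpace n) :
    (sqrtImPart Z : Matrix (Fin n) (Fin n) ℂ)ᴴ = (sqrtImPart Z : Matrix (Fin n) (Fin n) ℂ) := by
  have h : (CFC.sqrt (imPart Z)).IsSymm := by
    simpa using (CFC.sqrt_nonneg (imPart Z)).posSemidef.1
  rw [sqrtImPart, IsUnit.unit_spec, conjTranspose_ofReal_map, ← transpose_map, h.eq]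

lemma norm_det_sqrtImPart_sq (Z : siegelUpperHalfSpace n) :
    ‖(sqrtImPart Z : Matrix (Fin n) (Fin n) ℂ).det‖ ^ 2 = (imPart Z).det := by
  have h := congrArg (fun M => ‖Matrix.det M‖) (sqrtImPart_mul_self Z)
  simp only [det_mul, norm_mul, det_map_ofReal, Complex.norm_real,
    Real.norm_of_nonneg (det_imPart_pos Z).le] at h
  rw [sq, h]

lemma norm_det_sqrtImPart_pow (Z : siegelUpperHalfSpace n) (l : ℕ) :
    ‖(sqrtImPart Z : Matrix (Fin n) (Fin n) ℂ).det‖ ^ l = (imPart Z).det ^ ((l : ℝ) / 2) := by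
  rw [← norm_det_sqrtImPart_sq, ← Real.rpow_natCast _ 2, ← Real.rpow_mul (norm_nonneg _),
    ← Real.rpow_natCast]
  congr 1
  push_cast
  ring

/-- With `R = Y^{-1/2}`, the identity `R^*R = Y⁻¹` makes the squared length of each column a
diagonal entry of `Y⁻¹`. This supplies the boundedness of `s⁻¹` required by `HasDetGrowth`. -/
lemma norm_inv_sqrtImPart_apply_le {Z : siegelUpperHalfSpace n} {c : ℝ} (hc : 0 < c)
    (hZ : ∀ x, c * (x ⬝ᵥ x) ≤ quadForm (imPart Z) x) (i j : Fin n) :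
    ‖(((sqrtImPart Z)⁻¹ : GL (Fin n) ℂ) : Matrix (Fin n) (Fin n) ℂ) i j‖ ≤ √(n * c⁻¹) := by
  set R := (((sqrtImPart Z)⁻¹ : GL (Fin n) ℂ) : Matrix (Fin n) (Fin n) ℂ) with hR
  have hR2 : Rᴴ * R = (imPart Z)⁻¹.map Complex.ofReal := by
    have hu : IsUnit (imPart Z).det := isUnit_iff_ne_zero.2 (det_imPart_pos Z).ne'
    have h1 : Rᴴ = R := by
      rw [hR, coe_units_inv, conjTranspose_nonsing_inv, conjTranspose_sqrtImPart]
    have h2 : (imPart Z).map Complex.ofReal * (imPart Z)⁻¹.map Complex.ofReal = 1 := by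
      rw [← map_ofReal_mul, mul_nonsing_inv _ hu]
      simp
    rw [h1, hR, coe_units_inv, ← Matrix.mul_inv_rev, sqrtImPart_mul_self, inv_eq_right_inv h2]
  have h1 := congrArg (fun M : Matrix (Fin n) (Fin n) ℂ => (M j j).re) hR2
  simp only [mul_apply, conjTranspose_apply, map_apply, Complex.ofReal_re, Complex.re_sum] at h1
  have h2 : ∀ k, (star (R k j) * R k j).re = ‖R k j‖ ^ 2 := fun k => by
    rw [Complex.star_def, ← Complex.normSq_eq_conj_mul_self, Complex.ofReal_re,
      Complex.normSq_eq_norm_sq]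
  simp only [h2] at h1
  have h3 : ‖R i j‖ ^ 2 ≤ n * c⁻¹ :=
    calc ‖R i j‖ ^ 2 ≤ ∑ k, ‖R k j‖ ^ 2 :=
          Finset.single_le_sum (f := fun k => ‖R k j‖ ^ 2) (fun _ _ => sq_nonneg _)
            (Finset.mem_univ i)
      _ = (imPart Z)⁻¹ j j := h1
      _ ≤ (imPart Z)⁻¹.trace := (le_abs_self _).trans (abs_apply_le_trace Z.2.2.inv.posSemidef j j)
      _ ≤ n * c⁻¹ := trace_inv_le_of_le_quadForm Z.2.2 hc hZ
  exact Real.le_sqrt_of_sq_le h3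

/-- Both `Y^{1/2}` and `(Im gZ)^{1/2} J(g,Z)` are solutions `X` of `X^*X = Y`, so they differ by a
unitary factor on the left. -/
lemma sqrtImPart_mul_inv_automorphyFactor_mem (g : symplecticGroup (Fin n) ℝ)
    (Z : siegelUpperHalfSpace n) :
    ((sqrtImPart Z * (automorphyFactor g Z)⁻¹ * (sqrtImPart (moebius g Z))⁻¹ : GL (Fin n) ℂ) :
      Matrix (Fin n) (Fin n) ℂ) ∈ unitaryGroup (Fin n) ℂ := by
  set s := sqrtImPart Z
  set r := sqrtImPart (moebius g Z)
  set J := automorphyFactor g Z with hJ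
  set k : GL (Fin n) ℂ := s * J⁻¹ * r⁻¹ with hk
  have e : (s : Matrix (Fin n) (Fin n) ℂ) = k * (r * J : GL (Fin n) ℂ) := by
    rw [← Units.val_mul, hk]
    congr 1
    group
  have h1 : ((r * J : GL (Fin n) ℂ) : Matrix (Fin n) (Fin n) ℂ)ᴴ *
      (r * J : GL (Fin n) ℂ) = (s : Matrix (Fin n) (Fin n) ℂ)ᴴ * s := by
    rw [conjTranspose_sqrtImPart, sqrtImPart_mul_self, ← denomMatrix_conj_imPart g Z,
      ← sqrtImPart_mul_self (moebius g Z), Units.val_mul, conjTranspose_mul,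
      conjTranspose_sqrtImPart]
    simp only [Matrix.mul_assoc]
    rfl
  rw [e, conjTranspose_mul] at h1
  set t := (r * J : GL (Fin n) ℂ)
  have ht : IsUnit (t : Matrix (Fin n) (Fin n) ℂ) := t.isUnit
  have htH : IsUnit (t : Matrix (Fin n) (Fin n) ℂ)ᴴ := by
    rw [← star_eq_conjTranspose]
    exact ht.star
  rw [mem_unitaryGroup_iff', star_eq_conjTranspose]
  apply htH.mul_left_cancel
  apply ht.mul_right_cancel
  rw [Matrix.mul_one, h1]
  simp only [Matrix.mul_assoc]

variable {V : Type*} [NormedAddCommGroup V] [InnerProductSpace ℂ V]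

/-- The invariant norm of `F|g` at `Z` is the invariant norm of `F` at `gZ`. -/
lemma norm_sqrtImPart_slash (ρ : Representation ℂ (GL (Fin n) ℂ) V)
    (hρ : ∀ k : GL (Fin n) ℂ, (k : Matrix (Fin n) (Fin n) ℂ) ∈ unitaryGroup (Fin n) ℂ →
      ∀ w : V, ‖ρ k w‖ = ‖w‖)
    (F : siegelUpperHalfSpace n → V) (g : symplecticGroup (Fin n) ℝ)
    (Z : siegelUpperHalfSpace n) :
    ‖ρ (sqrtImPart Z) (slash ρ F g Z)‖ =
      ‖ρ (sqrtImPart (moebius g Z)) (F (moebius g Z))‖ := by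
  rw [slash, ← hρ _ (sqrtImPart_mul_inv_automorphyFactor_mem g Z)
      (ρ (sqrtImPart (moebius g Z)) (F (moebius g Z))), ← Module.End.mul_apply,
    ← Module.End.mul_apply, ← map_mul, ← map_mul, inv_mul_cancel_right]

/-! ### Finitely many cosets -/

lemma exists_finset_mul_of_relIndex_ne_zero {G : Type*} [Group G] {Γ K : Subgroup G}
    (h : Γ.relIndex K ≠ 0) : ∃ T : Finset G, ∀ g ∈ K, ∃ γ ∈ Γ, ∃ t ∈ T, g = γ * t := by
  classical
  have : (Γ.subgroupOf K).FiniteIndex := ⟨h⟩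
  have := Fintype.ofFinite (K ⧸ Γ.subgroupOf K)
  -- The quotient consists of left cosets; inverting representatives gives the right cosets `Γt`.
  refine ⟨Finset.univ.image fun q : K ⧸ Γ.subgroupOf K => ((q.out : K) : G)⁻¹, fun g hg => ?_⟩
  have hq := QuotientGroup.mk_out_eq_mul (Γ.subgroupOf K) (⟨g, hg⟩⁻¹ : K)
  obtain ⟨δ, hδ⟩ := hq
  refine ⟨((δ : K) : G), Subgroup.mem_subgroupOf.1 δ.2, _, Finset.mem_image_of_mem _
    (Finset.mem_univ (((⟨g, hg⟩⁻¹ : K) : K ⧸ Γ.subgroupOf K))), ?_⟩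
  rw [hδ]
  simp

/-! ### Growth of nearly holomorphic forms -/

/-- Expand `F(Z)` in a basis: the coordinates are bounded by the Fourier expansion, and `ρ(Y^{1/2})`
of each basis vector by determinantal growth. -/
lemma exists_bound_of_hasNiceFourierExpansion [FiniteDimensional ℂ V]
    (ρ : Representation ℂ (GL (Fin n) ℂ) V) {l : ℕ} (hl : ∀ w, HasDetGrowth ρ l w)
    {p : ℕ} {F : siegelUpperHalfSpace n → V}
    (hF : ∀ L : V →ₗ[ℂ] ℂ, HasNiceFourierExpansion p fun Z => L (F Z)) {c : ℝ} (hc : 0 < c) :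
    ∃ B : ℝ, ∀ Z, (∀ x, c * (x ⬝ᵥ x) ≤ quadForm (imPart Z) x) →
      ‖ρ (sqrtImPart Z) (F Z)‖ ≤ B * (imPart Z).det ^ ((l : ℝ) / 2) := by
  set b := Module.finBasis ℂ V
  choose B hB using fun i => (hF (b.coord i)).bounded hc
  choose C hC using fun i => hl (b i) √(n * c⁻¹)
  refine ⟨∑ i, B i * C i, fun Z hZ => ?_⟩
  conv_lhs => rw [← b.sum_repr (F Z), map_sum]
  refine (norm_sum_le _ _).trans ?_
  rw [Finset.sum_mul]
  refine Finset.sum_le_sum fun i _ => ?_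
  rw [map_smul, norm_smul, mul_assoc, ← norm_det_sqrtImPart_pow]
  have h1 := hB i Z hZ
  exact mul_le_mul h1 (hC i _ (norm_inv_sqrtImPart_apply_le hc hZ)) (norm_nonneg _)
    ((norm_nonneg _).trans h1)

lemma spMap_algebraMap_intCast (g : symplecticGroup (Fin n) ℤ) :
    spMap n (algebraMap ℚ ℝ) (spMap n (Int.castRingHom ℚ) g) = ofInt g := by
  apply Subtype.ext
  ext i j
  simp [spMap, ofInt]

/-- The invariant norm of a nearly holomorphic form grows at most like a power of the maximal
height of the orbit under `Sp_{2n}(ℤ)`. -/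
lemma exists_bound_det_imPart_moebius [FiniteDimensional ℂ V]
    (ρ : Representation ℂ (GL (Fin n) ℂ) V)
    (hρ : ∀ k : GL (Fin n) ℂ, (k : Matrix (Fin n) (Fin n) ℂ) ∈ unitaryGroup (Fin n) ℂ →
      ∀ w : V, ‖ρ k w‖ = ‖w‖)
    {l : ℕ} (hl : ∀ w, HasDetGrowth ρ l w)
    {F : siegelUpperHalfSpace n → V} (hF : F ∈ nearlyHolomorphicForms ρ) :
    ∃ B : ℝ, 0 ≤ B ∧ ∀ Z, ∃ g : symplecticGroup (Fin n) ℤ,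
      ‖ρ (sqrtImPart Z) (F Z)‖ ≤ B * (imPart (moebius (ofInt g) Z)).det ^ ((l : ℝ) / 2) := by
  obtain ⟨Γ, ⟨hΓ, -⟩, p, hN, hinv⟩ := hF
  obtain ⟨T, hT⟩ := exists_finset_mul_of_relIndex_ne_zero hΓ.1
  obtain ⟨c, hc, hred⟩ := exists_moebius_imPart_ge n
  choose B hB using fun t => exists_bound_of_hasNiceFourierExpansion ρ hl
    (fun L => (hN t L).2) hc
  refine ⟨∑ t ∈ T, |B t|, Finset.sum_nonneg fun _ _ => abs_nonneg _, fun Z => ?_⟩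
  obtain ⟨g, hg⟩ := hred Z
  -- Writing `g⁻¹ = γt` gives `Z = γ(tW)` with `W = gZ` reduced. Invariance under `γ` moves the norm
  -- from `Z` to `tW`, and the slash identity turns it into the norm of `F|t` at `W`.
  obtain ⟨γ, hγ, t, ht, hgt⟩ := hT (spMap n (Int.castRingHom ℚ) g⁻¹) ⟨g⁻¹, rfl⟩
  refine ⟨g, ?_⟩
  set W := moebius (ofInt g) Z with hW
  set t' := spMap n (algebraMap ℚ ℝ) t with ht'
  have hZ : moebius (spMap n (algebraMap ℚ ℝ) γ) (moebius t' W) = Z := by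
    rw [← moebius_mul, ht', ← map_mul, ← hgt, spMap_algebraMap_intCast, hW, ← moebius_mul,
      ← ofInt_mul, inv_mul_cancel]
    simp [ofInt, moebius_one]
  have h1 := norm_sqrtImPart_slash ρ hρ F (spMap n (algebraMap ℚ ℝ) γ) (moebius t' W)
  have h2 : slash ρ F (spMap n (algebraMap ℚ ℝ) γ) = F := hinv γ hγ
  rw [h2, hZ, ← norm_sqrtImPart_slash ρ hρ F t' W] at h1
  rw [← h1]
  refine (hB t W hg).trans ?_
  gcongr
  · exact Real.rpow_nonneg (det_imPart_pos W).le _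
  · exact (le_abs_self _).trans
      (Finset.single_le_sum (f := fun t => |B t|) (fun _ _ => abs_nonneg _) ht)

end Forms

end NearlyHolomorphicSiegel

end

/-! ### The growth estimate -/

theorem mainTheorem3 (n : ℕ) (hn : 0 < n)
    {V : Type*} [NormedAddCommGroup V] [InnerProductSpace ℂ V] [FiniteDimensional ℂ V]
    (ρ : Representation ℂ (Matrix.GeneralLinearGroup (Fin n) ℂ) V)
    (hρ_rat : NearlyHolomorphicSiegel.IsRational ρ) (hρ_irr : ρ.IsIrreducible)
    (hρ_unitary : ∀ k : Matrix.GeneralLinearGroup (Fin n) ℂ,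
      (k : Matrix (Fin n) (Fin n) ℂ) ∈ Matrix.unitaryGroup (Fin n) ℂ →
        ∀ v w : V, inner ℂ (ρ k v) (ρ k w) = inner ℂ v w)
    (lam : Fin n → ℕ) (hlam_anti : Antitone lam) (hlam : NearlyHolomorphicSiegel.IsHighestWeight ρ lam)
    (F : NearlyHolomorphicSiegel.siegelUpperHalfSpace n → V) (hF : F ∈ NearlyHolomorphicSiegel.nearlyHolomorphicForms ρ) :
    ∃ C : ℝ, ∀ Z : NearlyHolomorphicSiegel.siegelUpperHalfSpace n,
      ‖ρ (NearlyHolomorphicSiegel.sqrtImPart Z) (F Z)‖ ≤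
        C * (1 + (NearlyHolomorphicSiegel.imPart Z).trace) ^ (n * lam ⟨0, hn⟩) *
          (NearlyHolomorphicSiegel.imPart Z).det ^ (-(lam ⟨0, hn⟩ : ℝ) / 2) := by
  open NearlyHolomorphicSiegel in
  set l := lam ⟨0, hn⟩ with hl
  have hρ : ∀ k : Matrix.GeneralLinearGroup (Fin n) ℂ,
      (k : Matrix (Fin n) (Fin n) ℂ) ∈ Matrix.unitaryGroup (Fin n) ℂ →
        ∀ w : V, ‖ρ k w‖ = ‖w‖ := fun k hk w => by
    rw [norm_eq_sqrt_re_inner (𝕜 := ℂ), hρ_unitary k hk, ← norm_eq_sqrt_re_inner]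
  have hgrowth := hasDetGrowth_of_irreducible ρ hρ_irr hρ
    (fun i => hlam_anti (show (⟨0, hn⟩ : Fin n) ≤ i from Nat.zero_le _)) hlam
  obtain ⟨B, hB0, hB⟩ := exists_bound_det_imPart_moebius ρ hρ hgrowth hF
  refine ⟨B * (n.factorial * 2 ^ n : ℝ) ^ l, fun Z => ?_⟩
  obtain ⟨g, hg⟩ := hB Z
  have hT := trace_imPart_nonneg Z
  have hd := det_imPart_pos Z
  have h1 : (imPart (moebius (ofInt g) Z)).det ^ ((l : ℝ) / 2) ≤
      (n.factorial * 2 ^ n : ℝ) ^ l * (1 + (imPart Z).trace) ^ (n * l) *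
        (imPart Z).det ^ (-(l : ℝ) / 2) := by
    -- The exponent `l/2` undoes the square in `K²/det Y`, leaving `K^l (det Y)^{-l/2}`; the trace
    -- part of `K^l` is `(1 + Tr Y)^{nl}`, and the rest goes into the constant.
    calc (imPart (moebius (ofInt g) Z)).det ^ ((l : ℝ) / 2)
        ≤ ((n.factorial * (2 * (1 + (imPart Z).trace)) ^ n) ^ 2 / (imPart Z).det) ^
            ((l : ℝ) / 2) := by
          have := det_imPart_moebius_le g Z
          have := (det_imPart_pos (moebius (ofInt g) Z)).le
          gcongr
      _ = (n.factorial * (2 * (1 + (imPart Z).trace)) ^ n) ^ l *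
            (imPart Z).det ^ (-(l : ℝ) / 2) := by
          rw [Real.div_rpow (by positivity) hd.le, ← Real.rpow_natCast _ 2,
            ← Real.rpow_mul (by positivity), neg_div, Real.rpow_neg hd.le, div_eq_mul_inv,
            ← Real.rpow_natCast _ l]
          congr 3
          push_cast
          ring
      _ = _ := by
          rw [mul_pow (2 : ℝ), pow_mul _ n l]
          ring
  calc ‖ρ (sqrtImPart Z) (F Z)‖ ≤ B * (imPart (moebius (ofInt g) Z)).det ^ ((l : ℝ) / 2) := hg
    _ ≤ B * ((n.factorial * 2 ^ n : ℝ) ^ l * (1 + (imPart Z).trace) ^ (n * l) *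
        (imPart Z).det ^ (-(l : ℝ) / 2)) := by gcongr
    _ = _ := by ring
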